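/- **Setting.** Let $\mathbb F\in\{\mathbb R,\mathbb C\}$, let $(\mathbb X,\|\cdot\|)$ be a quasi-Banach space over $\mathbb F$ (complete for a quasi-norm: $\|x\|=0$ iff $x=0$, $\|tx\|=|t|\|x\|$, $\|x+y\|\le\kappa(\|x\|+\|y\|)$), and let $\mathcal B=(e_n)_{n\ge1}$ be a semi-normalized Markushevich basis (M-basis) of $\mathbb X$ with biorthogonal functionals $(e_n^*)_{n\ge 1}\subset \mathbb X^*$: $e_i^*(e_j)=\delta_{ij}$; for some $c_1,c_2>0$, $c_1\le\|e_n\|,\|e_n^*\|_*\le c_2$ for all $n$; $\operatorname{span}\{e_n\}$ is dense; and $x=0$ if $e_n^*(x)=0$ for all $n$. Here $\mathbb N=\{1,2,\dots\}$. *Errors.* $S_m(x)=\sum_{n=1}^m e_n^*(x)e_n$ and $\beta_m(x)=\|x-S_m(x)\|$. A greedy ordering of $x$ is an injective map $\pi:\mathbb N\to\mathbb N$ with $\{n:e_n^*(x)\ne0\}\subset\pi(\mathbb N)$ and $|e_{\pi(i)}^*(x)|\ge|e_{\pi(j)}^*(x)|$ for $i\le j$; $G_m^\pi(x)=\sum_{n=1}^m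 e^*_{\pi(n)}(x)e_{\pi(n)}$, and $\gamma_m(x)=\sup_\pi\|x-G_m^\pi(x)\|$ over all greedy orderings $\pi$ of $x$. *Types of bases.* $\mathcal B$ is quasi-greedy if for some constant $C>0$, $\gamma_m(x)\le C\|x\|$ for all $x\in\mathbb X$, $m\in\mathbb N$; partially greedy if for some $C>0$, $\gamma_m(x)\le C\beta_m(x)$ for all $x,m$; Schauder if for some $C>0$, $\|S_m(x)\|\le C\|x\|$ for all $x,m$. *Weights.* A doubling weight is a sequence $\omega=(\omega(n))_{n\ge1}$ with $0<\omega(1)\le\omega(2)\le\cdots$, $\omega(n)\to\infty$, and $\omega(2n)\le\theta\,\omega(n)$ for all $n$, for some $\theta\ge1$. Its lower dilation index is $i_\omega=\sup_{M>1}\frac{\ln\varphi_\omega(M)}{\ln M}$, where $\varphi_\omega(M)=\inf_{k\ge1}\frac{\omega(Mk)}{\omega(k)}$ for integers $M\ge 1$. *Classes.* For $0<q<\infty$, $\mathcal G_q^\omega$ is the set of $x\in\mathbb X$ with $\|x\|_{\mathcal G_q^\omega}:=\|x\|+\big(\sum_{n\ge1}(\omega(n)\gamma_n(x))^q\frac1n\big)^{1/q}<\infty$;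 for $q=\infty$ the second term is $\sup_{n\ge1}\omega(n)\gamma_n(x)$. The class $\mathcal{PG}_q^\omega$ and $\|\cdot\|_{\mathcal{PG}_q^\omega}$ are defined in the same way with $\beta_n$ in place of $\gamma_n$. We write $Y\hookrightarrow Z$ if $Y\subset Z$ and there is $C>0$ with $\|x\|_Z\le C\|x\|_Y$ for all $x\in Y$. *Democracy functions.* For finite $A\subset\mathbb N$ and scalars $\varepsilon=(\varepsilon_n)_{n\in A}$ with $|\varepsilon_n|=1$ for all $n\in A$ (written $|\varepsilon|=1$), put $1_{\varepsilon A}=\sum_{n\in A}\varepsilon_ne_n$. Let $$h_l(m)=\inf_{|A|\ge m,\,|\varepsilon|=1}\|1_{\varepsilon A}\|,\qquad h_{R,l}(m,u)=\sup_{|A|=m,\,\max A\le u,\,|\varepsilon|=1}\|1_{\varepsilon A}\|\ (m\le u),\qquad h_{R,r}(m,u)=\inf_{|A|=m,\,\min A>u,\,|\varepsilon|=1}\|1_{\varepsilon A}\| .$$ A function $\psi:\mathbb N\to\mathbb N$ is characteristic if $\psi(m)\ge m$ for all $m$ and, for some $C>0$, $\sup_{u\ge m}h_{R,l}(m,u)\le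 C\,h_{R,l}(m,\psi(m))$ for all $m\in\mathbb N$. *Property (I):* (i) $\displaystyle\sup_{\ell\ge0,\,u\ge1}\frac{h_{R,r}(2^{\ell+1}u,u)}{h_{R,r}(2^\ell u,u)}<\infty$, and (ii) there are a characteristic function $\psi$ and a constant $C>0$ with $h_{R,r}(u,u)\le C\,h_{R,r}(m,u)$ for all $m,u\in\mathbb N$ with $u\le\psi(m)$. *Property (W$^*$):* there are $C_1,C_2>0$ such that for every $m\in\mathbb N$ there exist $A\subset\{n\in\mathbb N:n\le C_1m\}$ with $|A|=m$ and $|\varepsilon|=1$ such that $\|1_{\varepsilon A}\|\le C_2h_l(m)$. **Theorem.** Let $\omega$ be a doubling weight with $i_\omega>0$, and let $\mathcal B$ be a quasi-greedy M-basis of a quasi-Banach space $\mathbb X$. 1. If $\mathcal B$ is partially greedy, then $\mathcal{PG}_q^\omega\hookrightarrow\mathcal G_q^\omega$ for all $q\in(0,\infty]$. 2. If $\mathcal B$ is Schauder with Property (I) and Property (W$^*$), and $\mathcal{PG}_q^\omega\hookrightarrow\mathcal G_q^\omega$ for some $q\in(0,\infty]$, then $\mathcal B$ is partially greedy. -/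

import Mathlib

open scoped ENNReal BigOperators

namespace GreedyApprox

/-- A quasi-norm on a vector space over `𝕜` (the real or complex field). -/
structure QuasiNorm (𝕜 X : Type*) [RCLike 𝕜] [AddCommGroup X] [Module 𝕜 X] where
  toFun : X → ℝ
  nonneg : ∀ x, 0 ≤ toFun x
  eq_zero_iff : ∀ x, toFun x = 0 ↔ x = 0
  smul_eq : ∀ (t : 𝕜) (x : X), toFun (t • x) = ‖t‖ * toFun x
  add_le : ∃ κ : ℝ, 1 ≤ κ ∧ ∀ x y, toFun (x + y) ≤ κ * (toFun x + toFun y)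

instance {𝕜 X : Type*} [RCLike 𝕜] [AddCommGroup X] [Module 𝕜 X] :
    CoeFun (QuasiNorm 𝕜 X) (fun _ => X → ℝ) := ⟨QuasiNorm.toFun⟩

namespace QuasiNorm

/-- Completeness: every Cauchy sequence converges. A space with a complete quasi-norm is a
quasi-Banach space. -/
def IsComplete {𝕜 X : Type*} [RCLike 𝕜] [AddCommGroup X] [Module 𝕜 X]
    (N : QuasiNorm 𝕜 X) : Prop :=
  ∀ u : ℕ → X, (∀ ε : ℝ, 0 < ε → ∃ n₀ : ℕ, ∀ m n, n₀ ≤ m → n₀ ≤ n → N (u m - u n) < ε) →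
    ∃ x : X, ∀ ε : ℝ, 0 < ε → ∃ n₀ : ℕ, ∀ n, n₀ ≤ n → N (u n - x) < ε

/-- The norm of a linear functional, `sup {|f x| : ‖x‖ ≤ 1}` (infinite if `f` is unbounded). -/
noncomputable def dualNorm {𝕜 X : Type*} [RCLike 𝕜] [AddCommGroup X] [Module 𝕜 X]
    (N : QuasiNorm 𝕜 X) (f : X →ₗ[𝕜] 𝕜) : ℝ≥0∞ :=
  ⨆ (x : X) (_ : N x ≤ 1), ENNReal.ofReal ‖f x‖

end QuasiNorm

/-- A semi-normalized Markushevich basis together with its (unique) biorthogonal functionals.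
The vector written `e_n` (`n = 1, 2, …`) on paper is `e (n - 1)` here, so the paper's first `m`
indices `1, …, m` are the elements of `Finset.range m`. -/
structure MBasis {𝕜 X : Type*} [RCLike 𝕜] [AddCommGroup X] [Module 𝕜 X]
    (N : QuasiNorm 𝕜 X) where
  e : ℕ → X
  coord : ℕ → X →ₗ[𝕜] 𝕜
  biorthogonal : ∀ i j, coord i (e j) = if i = j then 1 else 0
  seminormalized : ∃ c₁ c₂ : ℝ, 0 < c₁ ∧ ∀ n,
    c₁ ≤ N (e n) ∧ N (e n) ≤ c₂ ∧
    ENNReal.ofReal c₁ ≤ N.dualNorm (coord n) ∧ N.dualNorm (coord n) ≤ ENNReal.ofReal c₂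
  dense_span : ∀ x : X, ∀ ε : ℝ, 0 < ε →
    ∃ y ∈ Submodule.span 𝕜 (Set.range e), N (x - y) < ε
  total : ∀ x : X, (∀ n, coord n x = 0) → x = 0

/-- `ρ` and `σ` are extended-valued functionals defining the classes `{ρ < ∞}` and `{σ < ∞}`.
The first class embeds continuously in the second one. -/
def ContEmbeds {X : Type*} (ρ σ : X → ℝ≥0∞) : Prop :=
  {x | ρ x < ⊤} ⊆ {x | σ x < ⊤} ∧
    ∃ C : ℝ, 0 < C ∧ ∀ x, ρ x < ⊤ → σ x ≤ ENNReal.ofReal C * ρ x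

namespace MBasis

variable {𝕜 X : Type*} [RCLike 𝕜] [AddCommGroup X] [Module 𝕜 X] {N : QuasiNorm 𝕜 X}

/-- The partial sum `S_m(x)`. -/
noncomputable def partialSum (B : MBasis N) (m : ℕ) (x : X) : X :=
  ∑ n ∈ Finset.range m, B.coord n x • B.e n

/-- The error `β_m(x) = ‖x - S_m(x)‖`. -/
noncomputable def beta (B : MBasis N) (m : ℕ) (x : X) : ℝ≥0∞ :=
  ENNReal.ofReal (N (x - B.partialSum m x))

/-- `π` is a greedy ordering of `x`: it enumerates without repetition a set of indices that
contains the support of `x`, in nonincreasing order of the moduli of the coefficients. -/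
def IsGreedyOrdering (B : MBasis N) (x : X) (π : ℕ → ℕ) : Prop :=
  Function.Injective π ∧ {n | B.coord n x ≠ 0} ⊆ Set.range π ∧
    ∀ i j, i ≤ j → ‖B.coord (π j) x‖ ≤ ‖B.coord (π i) x‖

/-- The greedy sum `G_m^π(x)`. -/
noncomputable def greedySum (B : MBasis N) (π : ℕ → ℕ) (m : ℕ) (x : X) : X :=
  ∑ n ∈ Finset.range m, B.coord (π n) x • B.e (π n)

/-- The greedy error `γ_m(x)`, a supremum over all greedy orderings of `x`. -/
noncomputable def gamma (B : MBasis N) (m : ℕ) (x : X) : ℝ≥0∞ :=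
  ⨆ (π : ℕ → ℕ) (_ : B.IsGreedyOrdering x π), ENNReal.ofReal (N (x - B.greedySum π m x))

def IsSchauder (B : MBasis N) : Prop :=
  ∃ C : ℝ, 0 < C ∧ ∀ m : ℕ, 1 ≤ m → ∀ x : X, N (B.partialSum m x) ≤ C * N x

def IsQuasiGreedy (B : MBasis N) : Prop :=
  ∃ C : ℝ, 0 < C ∧ ∀ m : ℕ, 1 ≤ m → ∀ x : X, B.gamma m x ≤ ENNReal.ofReal (C * N x)

def IsPartiallyGreedy (B : MBasis N) : Prop :=
  ∃ C : ℝ, 0 < C ∧ ∀ m : ℕ, 1 ≤ m → ∀ x : X, B.gamma m x ≤ ENNReal.ofReal C * B.beta m x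

/-- The indicator sum `1_{εA}`. -/
noncomputable def indicatorSum (B : MBasis N) (ε : ℕ → 𝕜) (A : Finset ℕ) : X :=
  ∑ n ∈ A, ε n • B.e n

/-- The lower democracy function `h_l(m)`. -/
noncomputable def hl (B : MBasis N) (m : ℕ) : ℝ≥0∞ :=
  ⨅ (A : Finset ℕ) (ε : ℕ → 𝕜) (_ : m ≤ A.card ∧ ∀ n ∈ A, ‖ε n‖ = 1),
    ENNReal.ofReal (N (B.indicatorSum ε A))

/-- The left restricted democracy function `h_{R,l}(m,u)`, meant for `m ≤ u`: the supremum is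
over the sets of `m` indices among the first `u` ones. -/
noncomputable def hRl (B : MBasis N) (m u : ℕ) : ℝ≥0∞ :=
  ⨆ (A : Finset ℕ) (ε : ℕ → 𝕜)
    (_ : A.card = m ∧ (∀ n ∈ A, n < u) ∧ ∀ n ∈ A, ‖ε n‖ = 1),
    ENNReal.ofReal (N (B.indicatorSum ε A))

/-- The right restricted democracy function `h_{R,r}(m,u)`: the infimum is over the sets of `m`
indices that avoid the first `u` ones. -/
noncomputable def hRr (B : MBasis N) (m u : ℕ) : ℝ≥0∞ :=
  ⨅ (A : Finset ℕ) (ε : ℕ → 𝕜)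
    (_ : A.card = m ∧ (∀ n ∈ A, u ≤ n) ∧ ∀ n ∈ A, ‖ε n‖ = 1),
    ENNReal.ofReal (N (B.indicatorSum ε A))

/-- `ψ` is a characteristic function of `h_{R,l}`. -/
def IsCharacteristic (B : MBasis N) (ψ : ℕ → ℕ) : Prop :=
  (∀ m, 1 ≤ m → m ≤ ψ m) ∧
    ∃ C : ℝ, 0 < C ∧ ∀ m, 1 ≤ m →
      (⨆ (u : ℕ) (_ : m ≤ u), B.hRl m u) ≤ ENNReal.ofReal C * B.hRl m (ψ m)

/-- Property (I). -/
def PropertyI (B : MBasis N) : Prop :=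
  (⨆ (l : ℕ) (u : ℕ) (_ : 1 ≤ u), B.hRr (2 ^ (l + 1) * u) u / B.hRr (2 ^ l * u) u) < ⊤ ∧
    ∃ ψ : ℕ → ℕ, B.IsCharacteristic ψ ∧
      ∃ C : ℝ, 0 < C ∧ ∀ m u : ℕ, 1 ≤ m → 1 ≤ u → u ≤ ψ m →
        B.hRr u u ≤ ENNReal.ofReal C * B.hRr m u

/-- Property (W*). The index called `n` here is the paper's `n + 1`. -/
def PropertyWStar (B : MBasis N) : Prop :=
  ∃ C₁ C₂ : ℝ, 0 < C₁ ∧ 0 < C₂ ∧ ∀ m : ℕ, 1 ≤ m →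
    ∃ (A : Finset ℕ) (ε : ℕ → 𝕜), A.card = m ∧ (∀ n ∈ A, (n : ℝ) + 1 ≤ C₁ * m) ∧
      (∀ n ∈ A, ‖ε n‖ = 1) ∧
      ENNReal.ofReal (N (B.indicatorSum ε A)) ≤ ENNReal.ofReal C₂ * B.hl m

open Classical in
/-- `‖x‖ + (∑_{n ≥ 1} (ω(n) E_n(x))^q / n)^{1/q}` for `q < ∞` and
`‖x‖ + sup_{n ≥ 1} ω(n) E_n(x)` for `q = ∞`, where `E_n(x)` is an error functional. -/
noncomputable def classNorm (N : QuasiNorm 𝕜 X) (E : ℕ → X → ℝ≥0∞) (ω : ℕ → ℝ) (q : ℝ≥0∞)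
    (x : X) : ℝ≥0∞ :=
  ENNReal.ofReal (N x) +
    if q = ⊤ then ⨆ n : ℕ, ENNReal.ofReal (ω (n + 1)) * E (n + 1) x
    else (∑' n : ℕ, (ENNReal.ofReal (ω (n + 1)) * E (n + 1) x) ^ q.toReal
      / ((n + 1 : ℕ) : ℝ≥0∞)) ^ (1 / q.toReal)

/-- The functional defining the greedy class `𝒢_q^ω`. -/
noncomputable def greedyNorm (B : MBasis N) (ω : ℕ → ℝ) (q : ℝ≥0∞) : X → ℝ≥0∞ :=
  classNorm N B.gamma ω q

/-- The functional defining the partially greedy class `𝒫𝒢_q^ω`. -/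
noncomputable def partiallyGreedyNorm (B : MBasis N) (ω : ℕ → ℝ) (q : ℝ≥0∞) : X → ℝ≥0∞ :=
  classNorm N B.beta ω q

end MBasis

/-- A doubling weight `(ω(n))_{n ≥ 1}`: positive, nondecreasing, tending to infinity, and with
`ω(2n) ≤ θ ω(n)`. The value `ω 0` is never used. -/
def IsDoublingWeight (ω : ℕ → ℝ) : Prop :=
  0 < ω 1 ∧ (∀ m n, 1 ≤ m → m ≤ n → ω m ≤ ω n) ∧ Filter.Tendsto ω Filter.atTop Filter.atTop ∧
    ∃ θ : ℝ, 1 ≤ θ ∧ ∀ n, 1 ≤ n → ω (2 * n) ≤ θ * ω n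

/-- The lower dilation sequence `φ_ω(M) = inf_{k ≥ 1} ω(Mk) / ω(k)`. -/
noncomputable def lowerDilation (ω : ℕ → ℝ) (M : ℕ) : ℝ :=
  ⨅ k : {k : ℕ // 1 ≤ k}, ω (M * k) / ω k

/-- The lower dilation index `i_ω = sup_{M > 1} ln φ_ω(M) / ln M`. -/
noncomputable def lowerDilationIndex (ω : ℕ → ℝ) : EReal :=
  ⨆ (M : ℕ) (_ : 1 < M), ((Real.log (lowerDilation ω M) / Real.log M : ℝ) : EReal)

end GreedyApprox

/-!
Part 1 is the pointwise bound `γ_n ≤ C β_n`.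

For Part 2, quasi-greediness makes truncation operators bounded, so it is enough to prove that the
basis is super-conservative: `‖1_{εA}‖ ≲ ‖1_{δD}‖` whenever `|A| = |D|` and `A` lies to the left
of `D`. The embedding is tested on `x = 1_{ε[1,u]} + 1_{δD}`, where `D` lies to the right of `u`
and comes from Property (W*), with `|D|` about `2^{l+2} u`. The errors `β_n(x)` are controlled by
`‖x‖` for `n ≤ u` and by `‖1_{δD}‖` afterwards, and they vanish for `n ≥ T u`. Greedy sums of
length `n ≤ |D|` may be taken inside `D`, so `γ_n(x) ≳ ‖1_{ε[1,u]}‖` there. This gives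
`ω(2^l u) ‖1_{ε[1,u]}‖ ≲ ω(u) ‖1_{ε[1,u]}‖ + ω(T u) ‖1_{δD}‖`, and since `i_ω > 0` the first term
on the right is absorbed once `l` is large. Hence `h_{R,l}(u,u) ≲ h_{R,r}(u,u)` by Property (I)(i),
and Property (I)(ii) with its characteristic function turns this into
`h_{R,l}(m,u) ≲ h_{R,r}(m,u)` for all `m ≤ u`, which is super-conservativeness.
-/

namespace GreedyApprox

namespace QuasiNorm

variable {𝕜 X : Type*} [RCLike 𝕜] [AddCommGroup X] [Module 𝕜 X]

/-- A constant `κ ≥ 1` in the quasi-triangle inequality, chosen once and for all. -/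
noncomputable def modulus (N : QuasiNorm 𝕜 X) : ℝ := Classical.choose N.add_le

lemma one_le_modulus (N : QuasiNorm 𝕜 X) : 1 ≤ N.modulus := (Classical.choose_spec N.add_le).1

lemma modulus_pos (N : QuasiNorm 𝕜 X) : 0 < N.modulus := one_pos.trans_le N.one_le_modulus

lemma add_le_modulus (N : QuasiNorm 𝕜 X) (x y : X) : N (x + y) ≤ N.modulus * (N x + N y) :=
  (Classical.choose_spec N.add_le).2 x y

lemma add_le_of_le (N : QuasiNorm 𝕜 X) {x y : X} {a b : ℝ} (hx : N x ≤ a) (hy : N y ≤ b) :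
    N (x + y) ≤ N.modulus * (a + b) :=
  (N.add_le_modulus x y).trans <| by have := N.modulus_pos.le; gcongr

lemma map_zero (N : QuasiNorm 𝕜 X) : N 0 = 0 := (N.eq_zero_iff 0).2 rfl

lemma map_neg (N : QuasiNorm 𝕜 X) (x : X) : N (-x) = N x := by simpa using N.smul_eq (-1) x

lemma sub_le_of_le (N : QuasiNorm 𝕜 X) {x y : X} {a b : ℝ} (hx : N x ≤ a) (hy : N y ≤ b) :
    N (x - y) ≤ N.modulus * (a + b) := by
  rw [sub_eq_add_neg]
  exact N.add_le_of_le hx (by rwa [N.map_neg])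

lemma exists_sum_le {ι : Type*} (N : QuasiNorm 𝕜 X) (s : Finset ι) :
    ∃ K : ℝ, 0 ≤ K ∧ ∀ (f : ι → X) (M : ℝ), (∀ i ∈ s, N (f i) ≤ M) →
      N (∑ i ∈ s, f i) ≤ K * M := by
  classical
  induction s using Finset.induction_on with
  | empty => exact ⟨0, le_rfl, fun f M _ => by simp [N.map_zero]⟩
  | insert j s hj ih =>
    obtain ⟨K, hK, h⟩ := ih
    refine ⟨N.modulus * (1 + K), mul_nonneg N.modulus_pos.le (by positivity), fun f M hf => ?_⟩
    rw [Finset.sum_insert hj, mul_assoc, one_add_mul]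
    exact N.add_le_of_le (hf j (s.mem_insert_self j))
      (h f M fun i hi => hf i (Finset.mem_insert_of_mem hi))

end QuasiNorm

section NullSequence

open Filter Topology

variable {w : ℕ → ℝ}

lemma exists_notMem_forall_notMem_le (hw₀ : ∀ n, 0 ≤ w n) (hw : Tendsto w cofinite (𝓝 0))
    (A : Finset ℕ) : ∃ n ∉ A, ∀ k ∉ A, w k ≤ w n := by
  by_cases h : ∃ n ∉ A, 0 < w n
  · obtain ⟨n, hnA, hn⟩ := h
    have hfin : {k | w n ≤ w k}.Finite := by
      simpa using eventually_cofinite.1 (hw.eventually_lt_const hn)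
    obtain ⟨m, ⟨hmA, hm⟩, hmax⟩ := Set.exists_max_image {k | k ∉ A ∧ w n ≤ w k} w
      (hfin.subset fun _ hk => hk.2) ⟨n, hnA, le_rfl⟩
    exact ⟨m, hmA, fun k hk => (le_total (w n) (w k)).elim (fun hnk => hmax k ⟨hk, hnk⟩) hm.trans'⟩
  · push Not at h
    obtain ⟨n, hn⟩ := Infinite.exists_notMem_finset A
    exact ⟨n, hn, fun k hk => (h k hk).trans (hw₀ n)⟩

lemma exists_injective_antitone (hw₀ : ∀ n, 0 ≤ w n) (hw : Tendsto w cofinite (𝓝 0)) :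
    ∃ π : ℕ → ℕ, Function.Injective π ∧ Function.support w ⊆ Set.range π ∧ Antitone (w ∘ π) := by
  choose next hnext hmax using exists_notMem_forall_notMem_le hw₀ hw
  let s : ℕ → Finset ℕ := fun n => (fun A => insert (next A) A)^[n] ∅
  have s_succ (n : ℕ) : s (n + 1) = insert (next (s n)) (s n) := Function.iterate_succ_apply' ..
  have s_mono : Monotone s :=
    monotone_nat_of_le_succ fun n => s_succ n ▸ Finset.subset_insert _ _
  have mem_s {i j : ℕ} (hij : i < j) : next (s i) ∈ s j :=
    s_mono hij (s_succ i ▸ Finset.mem_insert_self _ _)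
  have s_subset (n : ℕ) : ∀ k ∈ s n, ∃ i, next (s i) = k := by
    induction n with
    | zero => simp [s]
    | succ n ih => simpa [s_succ n] using ih
  have hinj : Function.Injective fun n => next (s n) :=
    .of_lt_imp_ne fun i j hij h => hnext (s j) (h ▸ mem_s hij)
  refine ⟨fun n => next (s n), hinj, fun k hk => ?_, fun i j hij =>
    hmax (s i) _ fun h => hnext (s j) (s_mono hij h)⟩
  by_contra hrange
  have hle (n : ℕ) : w k ≤ w (next (s n)) := hmax (s n) k fun h => hrange (s_subset n k h)
  have hlim : Tendsto (fun n => w (next (s n))) cofinite (𝓝 0) :=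
    hw.comp hinj.tendsto_cofinite
  exact hk ((ge_of_tendsto' hlim hle).antisymm (hw₀ k))

lemma exists_injective_antitone_image_eq (hw₀ : ∀ n, 0 ≤ w n) (hw : Tendsto w cofinite (𝓝 0))
    {G : Finset ℕ} (hG : ∀ n ∈ G, ∀ k ∉ G, w k ≤ w n) :
    ∃ π : ℕ → ℕ, Function.Injective π ∧ Function.support w ⊆ Set.range π ∧ Antitone (w ∘ π) ∧
      (Finset.range G.card).image π = G := by
  -- Raising `w` by `1` on `G` forces every nonincreasing enumeration to exhaust `G` first.
  let v : ℕ → ℝ := fun n => if n ∈ G then w n + 1 else w n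
  have hv₀ (n : ℕ) : 0 ≤ v n := by have := hw₀ n; simp only [v]; split_ifs <;> positivity
  have hv : Tendsto v cofinite (𝓝 0) :=
    hw.congr' <| G.eventually_cofinite_notMem.mono fun n hn => (if_neg hn).symm
  obtain ⟨π, hinj, hsupp, hanti⟩ := exists_injective_antitone hv₀ hv
  have G_first {i j : ℕ} (hi : π i ∉ G) (hij : i ≤ j) : π j ∉ G := fun hj => by
    have h₁ : w (π j) + 1 ≤ w (π i) := by simpa [v, hi, hj] using hanti hij
    linarith [hG _ hj _ hi]
  refine ⟨π, hinj, fun k hk => hsupp ?_, fun i j hij => ?_, ?_⟩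
  · have := hw₀ k
    simp only [v, Function.mem_support] at hk ⊢
    split_ifs <;> positivity
  · have h := hanti hij
    by_cases hi : π i ∈ G <;> by_cases hj : π j ∈ G
    · simpa [v, hi, hj] using h
    · exact hG _ hi _ hj
    · exact absurd hj (G_first hi hij)
    · simpa [v, hi, hj] using h
  · refine (Finset.eq_of_subset_of_card_le (fun n hn => ?_)
      (Finset.card_image_le.trans (Finset.card_range _).le)).symm
    obtain ⟨i, rfl⟩ := hsupp (show v n ≠ 0 by have := hw₀ n; simp only [v, if_pos hn]; positivity)
    have hsub : (Finset.range (i + 1)).image π ⊆ G := Finset.image_subset_iff.2 fun j hj => by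
      by_contra hjG
      exact G_first hjG (Finset.mem_range_succ_iff.1 hj) hn
    have hcard := Finset.card_le_card hsub
    rw [Finset.card_image_of_injective _ hinj, Finset.card_range] at hcard
    exact Finset.mem_image_of_mem π (Finset.mem_range.2 hcard)

end NullSequence

lemma QuasiNorm.norm_apply_le {𝕜 X : Type*} [RCLike 𝕜] [AddCommGroup X] [Module 𝕜 X]
    (N : QuasiNorm 𝕜 X) {f : X →ₗ[𝕜] 𝕜} {c : ℝ} (hc : 0 ≤ c)
    (hf : N.dualNorm f ≤ ENNReal.ofReal c) (x : X) : ‖f x‖ ≤ c * N x := by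
  rcases (N.nonneg x).eq_or_lt' with hx | hx
  · simp [(N.eq_zero_iff x).1 hx, N.map_zero]
  have hnorm : ‖((N x)⁻¹ : 𝕜)‖ = (N x)⁻¹ := by simp [abs_of_pos hx]
  have hunit : N (((N x)⁻¹ : 𝕜) • x) ≤ 1 := by
    rw [N.smul_eq, hnorm, inv_mul_cancel₀ hx.ne']
  have hle : ‖f (((N x)⁻¹ : 𝕜) • x)‖ ≤ c := (ENNReal.ofReal_le_ofReal_iff hc).1 <|
    (le_iSup₂ (f := fun y (_ : N y ≤ 1) => ENNReal.ofReal ‖f y‖) _ hunit).trans hf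
  rwa [map_smul, norm_smul, hnorm, inv_mul_le_iff₀ hx, mul_comm] at hle

namespace MBasis

variable {𝕜 X : Type*} [RCLike 𝕜] [AddCommGroup X] [Module 𝕜 X] {N : QuasiNorm 𝕜 X}

section Coordinates

open Filter Topology

variable (B : MBasis N)

/-- The coordinate projection `∑_{n ∈ G} e_n^*(x) e_n`. -/
noncomputable def coordProj (G : Finset ℕ) (x : X) : X :=
  B.indicatorSum (fun n => B.coord n x) G

lemma quasiNorm_e_pos (n : ℕ) : 0 < N (B.e n) := by
  obtain ⟨c₁, c₂, hc₁, h⟩ := B.seminormalized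
  exact hc₁.trans_le (h n).1

lemma exists_quasiNorm_e_le : ∃ c : ℝ, ∀ n, N (B.e n) ≤ c := by
  obtain ⟨c₁, c₂, -, h⟩ := B.seminormalized
  exact ⟨c₂, fun n => (h n).2.1⟩

lemma exists_norm_coord_le : ∃ c : ℝ, 0 < c ∧ ∀ n x, ‖B.coord n x‖ ≤ c * N x := by
  obtain ⟨c₁, c₂, hc₁, h⟩ := B.seminormalized
  have hc₂ : 0 < c₂ := hc₁.trans_le ((h 0).1.trans (h 0).2.1)
  exact ⟨c₂, hc₂, fun n => N.norm_apply_le hc₂.le (h n).2.2.2⟩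

lemma coord_indicatorSum (a : ℕ → 𝕜) (A : Finset ℕ) (k : ℕ) :
    B.coord k (B.indicatorSum a A) = if k ∈ A then a k else 0 := by
  simp [indicatorSum, map_sum, B.biorthogonal]

lemma coord_sub_coordProj (G : Finset ℕ) (x : X) (k : ℕ) :
    B.coord k (x - B.coordProj G x) = if k ∈ G then 0 else B.coord k x := by
  rw [map_sub, coordProj, coord_indicatorSum]
  split_ifs <;> simp

lemma indicatorSum_congr {A : Finset ℕ} {a b : ℕ → 𝕜} (h : ∀ n ∈ A, a n = b n) :
    B.indicatorSum a A = B.indicatorSum b A :=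
  Finset.sum_congr rfl fun n hn => by rw [h n hn]

lemma coordProj_indicatorSum (a : ℕ → 𝕜) {A G : Finset ℕ} (hGA : G ⊆ A) :
    B.coordProj G (B.indicatorSum a A) = B.indicatorSum a G :=
  B.indicatorSum_congr fun n hn => by rw [coord_indicatorSum, if_pos (hGA hn)]

lemma indicatorSum_sdiff (a : ℕ → 𝕜) {A G : Finset ℕ} (hGA : G ⊆ A) :
    B.indicatorSum a (A \ G) = B.indicatorSum a A - B.indicatorSum a G :=
  eq_sub_of_add_eq (Finset.sum_sdiff hGA)

lemma indicatorSum_union {A D : Finset ℕ} (h : Disjoint A D) (a : ℕ → 𝕜) :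
    B.indicatorSum a (A ∪ D) = B.indicatorSum a A + B.indicatorSum a D :=
  Finset.sum_union h

lemma indicatorSum_add (a b : ℕ → 𝕜) (A : Finset ℕ) :
    B.indicatorSum (fun n => a n + b n) A = B.indicatorSum a A + B.indicatorSum b A := by
  simp only [indicatorSum, add_smul, Finset.sum_add_distrib]

lemma quasiNorm_indicatorSum_smul (t : ℝ) (a : ℕ → 𝕜) (A : Finset ℕ) :
    N (B.indicatorSum (fun n => t • a n) A) = |t| * N (B.indicatorSum a A) := by
  have h : B.indicatorSum (fun n => t • a n) A = (t : 𝕜) • B.indicatorSum a A := by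
    simp only [indicatorSum, Finset.smul_sum, smul_smul, RCLike.real_smul_eq_coe_mul]
  rw [h, N.smul_eq, RCLike.norm_ofReal]

lemma tendsto_norm_coord (x : X) : Tendsto (fun n => ‖B.coord n x‖) cofinite (𝓝 0) := by
  obtain ⟨c, hc, hcoord⟩ := B.exists_norm_coord_le
  refine tendsto_order.2 ⟨fun δ hδ => .of_forall fun n => hδ.trans_le (norm_nonneg _),
    fun δ hδ => ?_⟩
  obtain ⟨y, hy, hxy⟩ := B.dense_span x (δ / c) (by positivity)
  obtain ⟨b, rfl⟩ := Finsupp.mem_span_range_iff_exists_finsupp.1 hy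
  filter_upwards [b.support.eventually_cofinite_notMem] with n hn
  have hbn : B.coord n (b.sum fun i t => t • B.e i) = 0 :=
    (B.coord_indicatorSum b b.support n).trans (if_neg hn)
  calc ‖B.coord n x‖ = ‖B.coord n (x - b.sum fun i t => t • B.e i)‖ := by
        rw [map_sub, hbn, sub_zero]
    _ ≤ c * N (x - b.sum fun i t => t • B.e i) := hcoord n _
    _ < δ := by rwa [mul_comm, ← lt_div_iff₀ hc]

end Coordinates

section GreedySets

variable (B : MBasis N)

/-- `G` is a greedy set of `x`: the coefficients on `G` dominate in modulus those off `G`. These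
are the sets of the first `G.card` indices in the greedy orderings of `x`. -/
def IsGreedySet (x : X) (G : Finset ℕ) : Prop :=
  ∀ n ∈ G, ∀ k ∉ G, ‖B.coord k x‖ ≤ ‖B.coord n x‖

variable {B}

lemma IsGreedyOrdering.isGreedySet_image_range {x : X} {π : ℕ → ℕ} (hπ : B.IsGreedyOrdering x π)
    (m : ℕ) : B.IsGreedySet x ((Finset.range m).image π) := by
  intro n hn k hk
  obtain ⟨i, hi, rfl⟩ := Finset.mem_image.1 hn
  by_cases hkx : B.coord k x = 0
  · simp [hkx]
  obtain ⟨j, rfl⟩ := hπ.2.1 hkx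
  have hmj : m ≤ j := by
    by_contra! hjm
    exact hk (Finset.mem_image_of_mem π (Finset.mem_range.2 hjm))
  exact hπ.2.2 i j ((Finset.mem_range.1 hi).le.trans hmj)

lemma IsGreedyOrdering.greedySum_eq {x : X} {π : ℕ → ℕ} (hπ : B.IsGreedyOrdering x π) (m : ℕ) :
    B.greedySum π m x = B.coordProj ((Finset.range m).image π) x := by
  rw [coordProj, indicatorSum, Finset.sum_image hπ.1.injOn, greedySum]

lemma IsGreedySet.exists_greedyOrdering {x : X} {G : Finset ℕ} (hG : B.IsGreedySet x G) :
    ∃ π, B.IsGreedyOrdering x π ∧ (Finset.range G.card).image π = G := by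
  obtain ⟨π, hinj, hsupp, hanti, himage⟩ := exists_injective_antitone_image_eq
    (fun _ => norm_nonneg _) (B.tendsto_norm_coord x) hG
  exact ⟨π, ⟨hinj, fun k hk => hsupp (norm_ne_zero_iff.2 hk), hanti⟩, himage⟩

lemma gamma_le_iff {m : ℕ} {x : X} {c : ℝ≥0∞} :
    B.gamma m x ≤ c ↔ ∀ G : Finset ℕ, B.IsGreedySet x G → G.card = m →
      ENNReal.ofReal (N (x - B.coordProj G x)) ≤ c := by
  refine iSup₂_le_iff.trans ⟨?_, fun h π hπ => ?_⟩
  · rintro h G hG rfl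
    obtain ⟨π, hπ, himage⟩ := hG.exists_greedyOrdering
    simpa only [hπ.greedySum_eq, himage] using h π hπ
  · rw [hπ.greedySum_eq]
    exact h _ (hπ.isGreedySet_image_range m)
      ((Finset.card_image_of_injective _ hπ.1).trans (Finset.card_range m))

lemma isGreedySet_indicatorSum {a : ℕ → 𝕜} {A G : Finset ℕ} (hGA : G ⊆ A)
    (hG : ∀ n ∈ G, ∀ k ∈ A \ G, ‖a k‖ ≤ ‖a n‖) : B.IsGreedySet (B.indicatorSum a A) G := by
  intro n hn k hk
  rw [coord_indicatorSum, coord_indicatorSum, if_pos (hGA hn)]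
  split_ifs with hkA
  · exact hG n hn k (Finset.mem_sdiff.2 ⟨hkA, hk⟩)
  · simp

variable (B) in
/-- The projections onto greedy sets and onto their complements are bounded by `C`. -/
def GreedyProjBound (C : ℝ) : Prop :=
  ∀ (x : X) (G : Finset ℕ), B.IsGreedySet x G →
    N (x - B.coordProj G x) ≤ C * N x ∧ N (B.coordProj G x) ≤ C * N x

lemma IsQuasiGreedy.exists_greedyProjBound (hB : B.IsQuasiGreedy) :
    ∃ C : ℝ, B.GreedyProjBound C := by
  obtain ⟨C, hC, h⟩ := hB
  have hκ := N.one_le_modulus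
  refine ⟨N.modulus * (1 + C), fun x G hG => ?_⟩
  have hx := N.nonneg x
  rcases G.eq_empty_or_nonempty with rfl | hne
  · simp only [coordProj, indicatorSum, Finset.sum_empty, sub_zero, N.map_zero]
    exact ⟨le_mul_of_one_le_left hx (by nlinarith), by positivity⟩
  have hcompl : N (x - B.coordProj G x) ≤ C * N x :=
    (ENNReal.ofReal_le_ofReal_iff (by positivity)).1
      (gamma_le_iff.1 (h G.card hne.card_pos x) G hG rfl)
  refine ⟨hcompl.trans (by gcongr; nlinarith), ?_⟩
  have hproj := N.sub_le_of_le le_rfl hcompl (x := x)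
  rwa [sub_sub_cancel, ← one_add_mul, ← mul_assoc] at hproj

end GreedySets

section Truncation

variable {B : MBasis N} {C : ℝ}

lemma GreedyProjBound.one_le (h : B.GreedyProjBound C) : 1 ≤ C := by
  have he := (h (B.e 0) ∅ fun n hn => absurd hn (Finset.notMem_empty n)).1
  rwa [coordProj, indicatorSum, Finset.sum_empty, sub_zero,
    le_mul_iff_one_le_left (B.quasiNorm_e_pos 0)] at he

lemma GreedyProjBound.indicatorSum_le (h : B.GreedyProjBound C) {a : ℕ → 𝕜} {A G : Finset ℕ}
    (hGA : G ⊆ A) (hG : ∀ n ∈ G, ∀ k ∈ A \ G, ‖a k‖ ≤ ‖a n‖) :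
    N (B.indicatorSum a (A \ G)) ≤ C * N (B.indicatorSum a A) ∧
      N (B.indicatorSum a G) ≤ C * N (B.indicatorSum a A) := by
  have := h _ G (isGreedySet_indicatorSum hGA hG)
  rwa [B.coordProj_indicatorSum a hGA, ← B.indicatorSum_sdiff a hGA] at this

lemma GreedyProjBound.indicator_le (h : B.GreedyProjBound C) {ε : ℕ → 𝕜} {D A : Finset ℕ}
    (hDA : D ⊆ A) (hε : ∀ n ∈ A, ‖ε n‖ = 1) :
    N (B.indicatorSum ε D) ≤ C * N (B.indicatorSum ε A) :=
  (h.indicatorSum_le hDA fun n hn k hk => by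
    rw [hε n (hDA hn), hε k (Finset.sdiff_subset hk)]).2

lemma GreedyProjBound.exists_nat_smul_indicator_le (h : B.GreedyProjBound C) (j : ℕ) :
    ∃ K : ℝ, 0 ≤ K ∧ ∀ (A : Finset ℕ) (ε : ℕ → 𝕜) (d : ℕ → ℕ), (∀ n ∈ A, ‖ε n‖ = 1) →
      (∀ n ∈ A, d n ≤ j) →
        N (B.indicatorSum (fun n => (d n : ℝ) • ε n) A) ≤ K * N (B.indicatorSum ε A) := by
  obtain ⟨K, hK, hsum⟩ := N.exists_sum_le (Finset.range j)
  refine ⟨K * C, mul_nonneg hK (zero_le_one.trans h.one_le), fun A ε d hε hd => ?_⟩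
  have hlayers : B.indicatorSum (fun n => (d n : ℝ) • ε n) A =
      ∑ i ∈ Finset.range j, B.indicatorSum ε (A.filter (i < d ·)) := by
    simp only [indicatorSum, Finset.sum_filter]
    rw [Finset.sum_comm]
    refine Finset.sum_congr rfl fun n hn => ?_
    have hfilter : (Finset.range j).filter (· < d n) = Finset.range (d n) := by
      ext i
      simpa using fun hi => hi.trans_le (hd n hn)
    rw [← Finset.sum_filter, hfilter, Finset.sum_const, Finset.card_range, Nat.cast_smul_eq_nsmul,
      smul_assoc]
  rw [hlayers, mul_assoc]
  exact hsum _ _ fun i _ => h.indicator_le (Finset.filter_subset _ _) hε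

lemma exists_indicatorSum_le (B : MBasis N) (A : Finset ℕ) :
    ∃ R : ℝ, ∀ a : ℕ → 𝕜, (∀ n ∈ A, ‖a n‖ ≤ 1) → N (B.indicatorSum a A) ≤ R := by
  obtain ⟨K, -, hsum⟩ := N.exists_sum_le A
  obtain ⟨c, hc⟩ := B.exists_quasiNorm_e_le
  refine ⟨K * c, fun a ha => hsum _ _ fun n hn => ?_⟩
  rw [N.smul_eq]
  exact (mul_le_of_le_one_left (N.nonneg _) (ha n hn)).trans (hc n)

lemma GreedyProjBound.exists_convex_indicator_le (h : B.GreedyProjBound C) :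
    ∃ K : ℝ, 0 ≤ K ∧ ∀ (A : Finset ℕ) (ε : ℕ → 𝕜) (r : ℕ → ℝ), (∀ n ∈ A, ‖ε n‖ = 1) →
      (∀ n ∈ A, r n ∈ Set.Icc 0 1) →
        N (B.indicatorSum (fun n => r n • ε n) A) ≤ K * N (B.indicatorSum ε A) := by
  obtain ⟨b, hb⟩ := exists_nat_ge (2 * N.modulus)
  have hκ := N.modulus_pos
  have hb₀ : (0 : ℝ) < b := by linarith
  obtain ⟨K, hK, hnat⟩ := h.exists_nat_smul_indicator_le b
  refine ⟨K, hK, fun A ε r hε hr => ?_⟩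
  let S : Set ℝ := {t | ∃ r : ℕ → ℝ, (∀ n ∈ A, r n ∈ Set.Icc 0 1) ∧
    N (B.indicatorSum (fun n => r n • ε n) A) = t}
  have hbdd : BddAbove S := by
    obtain ⟨R, hR⟩ := B.exists_indicatorSum_le A
    refine ⟨R, ?_⟩
    rintro _ ⟨r, hr, rfl⟩
    refine hR _ fun n hn => ?_
    rw [norm_smul, hε n hn, mul_one, Real.norm_of_nonneg (hr n hn).1]
    exact (hr n hn).2
  -- Writing `b r = ⌊b r⌋ + {b r}`, the supremum `s` of `S` satisfies `s ≤ (κ / b) (K M + s)`.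
  have hsup : sSup S ≤ (K * N (B.indicatorSum ε A) + sSup S) / 2 := by
    refine csSup_le ⟨_, r, hr, rfl⟩ ?_
    rintro _ ⟨r, hr, rfl⟩
    have hbr (n : ℕ) (hn : n ∈ A) : 0 ≤ b * r n := mul_nonneg hb₀.le (hr n hn).1
    have hfloor := hnat A ε (fun n => ⌊b * r n⌋₊) hε fun n hn =>
      Nat.floor_le_of_le (mul_le_of_le_one_right hb₀.le (hr n hn).2)
    have hfract : N (B.indicatorSum (fun n => (b * r n - ⌊b * r n⌋₊) • ε n) A) ≤ sSup S :=
      le_csSup hbdd ⟨_, fun n hn => ⟨sub_nonneg.2 (Nat.floor_le (hbr n hn)),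
        sub_le_iff_le_add'.2 (Nat.lt_floor_add_one _).le⟩, rfl⟩
    have hsum := N.add_le_of_le hfloor hfract
    rw [← indicatorSum_add, B.indicatorSum_congr (b := fun n => (b : ℝ) • r n • ε n)
      fun n _ => by rw [← add_smul, add_sub_cancel, mul_smul],
      quasiNorm_indicatorSum_smul, abs_of_pos hb₀] at hsum
    rw [le_div_iff₀ two_pos]
    refine le_of_mul_le_mul_left ?_ hκ
    nlinarith [N.nonneg (B.indicatorSum (fun n => r n • ε n) A)]
  have hr_le := le_csSup hbdd ⟨r, hr, rfl⟩
  linarith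

lemma GreedyProjBound.exists_smul_indicator_le (h : B.GreedyProjBound C) :
    ∃ K : ℝ, 0 ≤ K ∧ ∀ (A : Finset ℕ) (ε : ℕ → 𝕜) (r : ℕ → ℝ) (t : ℝ), (∀ n ∈ A, ‖ε n‖ = 1) →
      (∀ n ∈ A, r n ∈ Set.Icc 0 t) →
        N (B.indicatorSum (fun n => r n • ε n) A) ≤ K * (t * N (B.indicatorSum ε A)) := by
  obtain ⟨K, hK, hconv⟩ := h.exists_convex_indicator_le
  refine ⟨K, hK, fun A ε r t hε hr => ?_⟩
  rcases A.eq_empty_or_nonempty with rfl | ⟨k, hk⟩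
  · simp [indicatorSum, N.map_zero]
  have ht : 0 ≤ t := (hr k hk).1.trans (hr k hk).2
  have hcancel (n : ℕ) (hn : n ∈ A) : t * (r n / t) = r n :=
    mul_div_cancel_of_imp' fun ht₀ => le_antisymm (ht₀ ▸ (hr n hn).2) (hr n hn).1
  rw [B.indicatorSum_congr (b := fun n => t • (r n / t) • ε n)
    fun n hn => by rw [smul_smul, hcancel n hn], quasiNorm_indicatorSum_smul, abs_of_nonneg ht,
    mul_left_comm]
  gcongr
  exact hconv A ε _ hε fun n hn =>
    ⟨div_nonneg (hr n hn).1 ht, div_le_one_of_le₀ (hr n hn).2 ht⟩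

variable (B) in
/-- Indicator sums are dominated, up to the factor `K`, by the vectors with the same support and
the same signs whose coefficients have moduli in `[1, Λ]`. -/
def TruncationBound (Λ K : ℝ) : Prop :=
  ∀ (A : Finset ℕ) (ε : ℕ → 𝕜) (r : ℕ → ℝ), (∀ n ∈ A, ‖ε n‖ = 1) →
    (∀ n ∈ A, r n ∈ Set.Icc 1 Λ) →
      N (B.indicatorSum ε A) ≤ K * N (B.indicatorSum (fun n => r n • ε n) A)

lemma TruncationBound.mono {Λ Λ' K K' : ℝ} (h : B.TruncationBound Λ' K) (hΛ : Λ ≤ Λ')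
    (hK : K ≤ K') : B.TruncationBound Λ K' := fun A ε r hε hr =>
  (h A ε r hε fun n hn => ⟨(hr n hn).1, (hr n hn).2.trans hΛ⟩).trans
    (mul_le_mul_of_nonneg_right hK (N.nonneg _))

lemma GreedyProjBound.exists_truncationBound_near_one (h : B.GreedyProjBound C) :
    ∃ Λ : ℝ, 1 < Λ ∧ B.TruncationBound Λ (2 * N.modulus) := by
  obtain ⟨K, hK, hsmul⟩ := h.exists_smul_indicator_le
  have hκ := N.modulus_pos
  let δ : ℝ := 1 / (2 * N.modulus * (K + 1))
  have hδ : 0 < δ := by positivity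
  refine ⟨1 + δ, by linarith, fun A ε r hε hr => ?_⟩
  have hexcess := hsmul A ε (fun n => r n - 1) δ hε fun n hn =>
    ⟨sub_nonneg.2 (hr n hn).1, sub_le_iff_le_add'.2 (hr n hn).2⟩
  have hle := N.sub_le_of_le (le_refl (N (B.indicatorSum (fun n => r n • ε n) A))) hexcess
  rw [sub_eq_of_eq_add' (c := B.indicatorSum ε A) (by
    rw [← indicatorSum_add]
    exact B.indicatorSum_congr fun n _ => by rw [sub_smul, one_smul, sub_add_cancel])] at hle
  have hsmall : N.modulus * (K * δ) ≤ 1 / 2 := by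
    rw [← mul_assoc, mul_one_div, div_le_iff₀ (by positivity)]
    nlinarith
  nlinarith [N.nonneg (B.indicatorSum ε A)]

/-- The two factors in the estimate reflect the splitting of the vector at level `Λ`: dividing the
coefficients above that level by `Λ` gains a factor `Λ`. -/
lemma TruncationBound.mul (h : B.GreedyProjBound C) {Λ Λ' K L : ℝ} (hΛ : 0 < Λ)
    (hK : 0 ≤ K) (hL : 0 ≤ L) (hlow : B.TruncationBound Λ K) (hhigh : B.TruncationBound Λ' L) :
    B.TruncationBound (Λ * Λ') (N.modulus * (K * C + L * (C / Λ))) := by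
  intro A ε r hε hr
  let x := B.indicatorSum (fun n => r n • ε n) A
  let G := A.filter (Λ < r ·)
  have hGA : G ⊆ A := Finset.filter_subset _ _
  have mem_compl {n : ℕ} (hn : n ∈ A \ G) : n ∈ A ∧ r n ≤ Λ := by
    rwa [← Finset.filter_not, Finset.mem_filter, not_lt] at hn
  have hnorm (n : ℕ) (hn : n ∈ A) : ‖r n • ε n‖ = r n := by
    rw [norm_smul, hε n hn, mul_one, Real.norm_of_nonneg (zero_le_one.trans (hr n hn).1)]
  obtain ⟨hcompl, hproj⟩ := h.indicatorSum_le (a := fun n => r n • ε n) hGA fun n hn k hk => by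
    rw [hnorm n (hGA hn), hnorm k (mem_compl hk).1]
    exact (mem_compl hk).2.trans (Finset.mem_filter.1 hn).2.le
  have hlow' : N (B.indicatorSum ε (A \ G)) ≤ K * (C * N x) :=
    (hlow (A \ G) ε r (fun n hn => hε n (mem_compl hn).1) fun n hn =>
      ⟨(hr n (mem_compl hn).1).1, (mem_compl hn).2⟩).trans (by gcongr)
  have hhigh' : N (B.indicatorSum ε G) ≤ L * (Λ⁻¹ * (C * N x)) := by
    refine (hhigh G ε (fun n => Λ⁻¹ * r n) (fun n hn => hε n (hGA hn)) fun n hn => ?_).trans ?_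
    · exact ⟨(one_le_inv_mul₀ hΛ).2 (Finset.mem_filter.1 hn).2.le,
        (inv_mul_le_iff₀ hΛ).2 (hr n (hGA hn)).2⟩
    · simp only [mul_smul]
      rw [quasiNorm_indicatorSum_smul, abs_of_pos (inv_pos.2 hΛ)]
      gcongr
  have hsum := N.add_le_of_le hlow' hhigh'
  rw [B.indicatorSum_sdiff ε hGA, sub_add_cancel] at hsum
  exact hsum.trans_eq (by ring)

lemma GreedyProjBound.exists_truncationBound (h : B.GreedyProjBound C) (Λ : ℝ) :
    ∃ K : ℝ, 0 ≤ K ∧ B.TruncationBound Λ K := by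
  obtain ⟨lam, hlam, hnear⟩ := h.exists_truncationBound_near_one
  have hκ := N.modulus_pos
  have hC := zero_le_one.trans h.one_le
  have hpow (j : ℕ) : ∃ K : ℝ, 0 ≤ K ∧ B.TruncationBound (lam ^ j) K := by
    induction j with
    | zero => exact ⟨_, by positivity, hnear.mono (pow_zero lam ▸ hlam.le) le_rfl⟩
    | succ j ih =>
      obtain ⟨L, hL, hbound⟩ := ih
      rw [pow_succ']
      exact ⟨_, by positivity, .mul h (by positivity) (by positivity) hL hnear hbound⟩
  obtain ⟨j, hj⟩ := pow_unbounded_of_one_lt Λ hlam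
  obtain ⟨K, hK, hbound⟩ := hpow j
  exact ⟨K, hK, hbound.mono hj.le le_rfl⟩

lemma GreedyProjBound.exists_uniform_truncationBound (h : B.GreedyProjBound C) :
    ∃ K : ℝ, 0 ≤ K ∧ ∀ Λ, B.TruncationBound Λ K := by
  have hκ := N.one_le_modulus
  have hC := h.one_le
  -- For `Λ = 2 κ C` the constant `2 κ K₀ C` is reproduced by `TruncationBound.mul`.
  let Λ : ℝ := 2 * N.modulus * C
  have hΛ : 1 < Λ := by simp only [Λ]; nlinarith
  obtain ⟨K₀, hK₀, hbound⟩ := h.exists_truncationBound Λ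
  let K := 2 * N.modulus * K₀ * C
  have hK : 0 ≤ K := by positivity
  have hK₀K : K₀ ≤ K := by
    have : K = K₀ * Λ := by simp only [K, Λ]; ring
    exact this ▸ le_mul_of_one_le_right hK₀ hΛ.le
  have hfix : N.modulus * (K₀ * C + K * (C / Λ)) = K := by simp only [K, Λ]; field_simp; ring
  have hpow (j : ℕ) : B.TruncationBound (Λ ^ j) K := by
    induction j with
    | zero => exact hbound.mono (pow_zero Λ ▸ hΛ.le) hK₀K
    | succ j ih => rw [pow_succ', ← hfix]; exact .mul h (by positivity) hK₀ hK hbound ih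
  refine ⟨K, hK, fun Λ' => ?_⟩
  obtain ⟨j, hj⟩ := pow_unbounded_of_one_lt Λ' hΛ
  exact (hpow j).mono hj.le le_rfl

lemma GreedyProjBound.exists_indicator_le_smul (h : B.GreedyProjBound C) :
    ∃ K : ℝ, 0 ≤ K ∧ ∀ (A : Finset ℕ) (ε : ℕ → 𝕜) (r : ℕ → ℝ) (t : ℝ), (∀ n ∈ A, ‖ε n‖ = 1) →
      (∀ n ∈ A, t ≤ r n) →
        t * N (B.indicatorSum ε A) ≤ K * N (B.indicatorSum (fun n => r n • ε n) A) := by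
  obtain ⟨K, hK, hbound⟩ := h.exists_uniform_truncationBound
  refine ⟨K, hK, fun A ε r t hε hr => ?_⟩
  rcases le_or_gt t 0 with ht | ht
  · exact (mul_nonpos_of_nonpos_of_nonneg ht (N.nonneg _)).trans (mul_nonneg hK (N.nonneg _))
  have hle := hbound (∑ n ∈ A, t⁻¹ * r n) A ε (fun n => t⁻¹ * r n) hε fun n hn =>
    ⟨(one_le_inv_mul₀ ht).2 (hr n hn), Finset.single_le_sum (f := fun n => t⁻¹ * r n)
      (fun k hk => mul_nonneg (inv_nonneg.2 ht.le) (ht.le.trans (hr k hk))) hn⟩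
  simp only [mul_smul] at hle
  rwa [quasiNorm_indicatorSum_smul, abs_of_pos (inv_pos.2 ht), mul_left_comm,
    le_inv_mul_iff₀ ht] at hle

end Truncation
section SuperConservative

variable {B : MBasis N}

variable (B) in
/-- Super-conservativity: the norm of an indicator sum is controlled by the norms of all indicator
sums of the same length lying entirely to the right of it. -/
def IsSuperConservative : Prop :=
  ∃ C : ℝ, 0 ≤ C ∧ ∀ (A D : Finset ℕ) (ε δ : ℕ → 𝕜), A.card = D.card →
    (∀ n ∈ A, ∀ k ∈ D, n < k) → (∀ n ∈ A, ‖ε n‖ = 1) → (∀ n ∈ D, ‖δ n‖ = 1) →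
      N (B.indicatorSum ε A) ≤ C * N (B.indicatorSum δ D)

lemma IsSuperConservative.exists_indicatorSum_le (hB : B.IsSuperConservative) {C : ℝ}
    (h : B.GreedyProjBound C) :
    ∃ K : ℝ, 0 ≤ K ∧ ∀ (A D : Finset ℕ) (a : ℕ → 𝕜), A.card = D.card →
      (∀ n ∈ A, ∀ k ∈ D, n < k) → (∀ n ∈ A, ∀ k ∈ D, ‖a n‖ ≤ ‖a k‖) →
        N (B.indicatorSum a A) ≤ K * N (B.indicatorSum a D) := by
  obtain ⟨K₀, hK₀, hconserv⟩ := hB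
  obtain ⟨K₁, hK₁, hupper⟩ := h.exists_smul_indicator_le
  obtain ⟨K₂, hK₂, hlower⟩ := h.exists_indicator_le_smul
  refine ⟨K₁ * K₀ * K₂, by positivity, fun A D a hcard hlt hle => ?_⟩
  rcases D.eq_empty_or_nonempty with rfl | hD
  · simp [indicatorSum, Finset.card_eq_zero.1 hcard, N.map_zero]
  choose η hη ha using fun n => RCLike.exists_norm_mul_eq_self (a n)
  have hpolar (F : Finset ℕ) : B.indicatorSum a F = B.indicatorSum (fun n => ‖a n‖ • η n) F :=
    B.indicatorSum_congr fun n _ => by rw [RCLike.real_smul_eq_coe_mul, mul_comm, ha]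
  obtain ⟨d, hd, hmin⟩ := D.exists_min_image (fun n => ‖a n‖) hD
  rw [hpolar A, hpolar D]
  calc N (B.indicatorSum (fun n => ‖a n‖ • η n) A)
      ≤ K₁ * (‖a d‖ * N (B.indicatorSum η A)) :=
        hupper A η _ _ (fun n _ => hη n) fun n hn => ⟨norm_nonneg _, hle n hn d hd⟩
    _ ≤ K₁ * (‖a d‖ * (K₀ * N (B.indicatorSum η D))) := by
        gcongr
        exact hconserv A D η η hcard hlt (fun n _ => hη n) fun n _ => hη n
    _ = K₁ * K₀ * (‖a d‖ * N (B.indicatorSum η D)) := by ring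
    _ ≤ K₁ * K₀ * (K₂ * N (B.indicatorSum (fun n => ‖a n‖ • η n) D)) := by
        exact mul_le_mul_of_nonneg_left (hlower D η _ _ (fun n _ => hη n) hmin) (by positivity)
    _ = K₁ * K₀ * K₂ * N (B.indicatorSum (fun n => ‖a n‖ • η n) D) := by ring

lemma coord_sub_partialSum (B : MBasis N) (m : ℕ) (x : X) (k : ℕ) :
    B.coord k (x - B.partialSum m x) = if k ∈ Finset.range m then 0 else B.coord k x :=
  B.coord_sub_coordProj (Finset.range m) x k

lemma IsGreedySet.sdiff_range {x : X} {G : Finset ℕ} (hG : B.IsGreedySet x G) (m : ℕ) :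
    B.IsGreedySet (x - B.partialSum m x) (G \ Finset.range m) := fun n hn k hk => by
  obtain ⟨hnG, hnm⟩ := Finset.mem_sdiff.1 hn
  rw [coord_sub_partialSum, coord_sub_partialSum, if_neg hnm]
  split_ifs with hkm
  · simp
  · exact hG n hnG k fun hkG => hk (Finset.mem_sdiff.2 ⟨hkG, hkm⟩)

lemma coordProj_sub_partialSum (B : MBasis N) (G : Finset ℕ) (m : ℕ) (x : X) :
    B.coordProj (G \ Finset.range m) (x - B.partialSum m x) =
      B.coordProj (G \ Finset.range m) x :=
  B.indicatorSum_congr fun n hn => by rw [coord_sub_partialSum, if_neg (Finset.mem_sdiff.1 hn).2]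

lemma sub_coordProj_eq_sub_add (B : MBasis N) (G : Finset ℕ) (m : ℕ) (x : X) :
    x - B.coordProj G x =
      x - B.partialSum m x - B.coordProj (G \ Finset.range m) (x - B.partialSum m x) +
        B.coordProj (Finset.range m \ G) x := by
  have hexchange : B.coordProj (G \ Finset.range m) x - B.coordProj (Finset.range m \ G) x =
      B.coordProj G x - B.partialSum m x := Finset.sum_sdiff_sub_sum_sdiff
  rw [coordProj_sub_partialSum, sub_add, hexchange, sub_sub_sub_cancel_right]

lemma IsSuperConservative.isPartiallyGreedy (hB : B.IsSuperConservative)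
    (hqg : B.IsQuasiGreedy) : B.IsPartiallyGreedy := by
  obtain ⟨C, h⟩ := hqg.exists_greedyProjBound
  obtain ⟨K, hK, hcompare⟩ := hB.exists_indicatorSum_le h
  have hC := one_pos.trans_le h.one_le
  have hκ := N.modulus_pos
  refine ⟨N.modulus * (C + K * C), by positivity,
    fun m _ x => gamma_le_iff.2 fun G hG hGm => ?_⟩
  let y := x - B.partialSum m x
  obtain ⟨hcompl, hproj⟩ := h y _ (hG.sdiff_range m)
  rw [coordProj_sub_partialSum] at hproj
  have hcard : (Finset.range m \ G).card = (G \ Finset.range m).card :=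
    Finset.card_sdiff_comm (by rw [Finset.card_range, hGm])
  have hleft : N (B.coordProj (Finset.range m \ G) x) ≤ K * (C * N y) := by
    refine (hcompare _ _ (B.coord · x) hcard (fun n hn k hk => ?_) fun n hn k hk => ?_).trans
      (mul_le_mul_of_nonneg_left hproj hK)
    · simp only [Finset.mem_sdiff, Finset.mem_range, not_lt] at hn hk
      exact hn.1.trans_le hk.2
    · exact hG k (Finset.mem_sdiff.1 hk).1 n (Finset.mem_sdiff.1 hn).2
  rw [beta, ← ENNReal.ofReal_mul (by positivity), B.sub_coordProj_eq_sub_add G m]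
  refine ENNReal.ofReal_le_ofReal ((N.add_le_of_le hcompl hleft).trans_eq ?_)
  ring

end SuperConservative

end MBasis

namespace IsDoublingWeight

variable {ω : ℕ → ℝ}

lemma mono (hω : IsDoublingWeight ω) {m n : ℕ} (hm : 1 ≤ m) (hmn : m ≤ n) : ω m ≤ ω n :=
  hω.2.1 m n hm hmn

lemma pos (hω : IsDoublingWeight ω) {n : ℕ} (hn : 1 ≤ n) : 0 < ω n :=
  hω.1.trans_le (hω.mono le_rfl hn)

lemma exists_dilation (hω : IsDoublingWeight ω) (hi : 0 < lowerDilationIndex ω) :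
    ∃ (M : ℕ) (φ : ℝ), 1 < M ∧ 1 < φ ∧ ∀ k, 1 ≤ k → φ * ω k ≤ ω (M * k) := by
  obtain ⟨M, hM, hlog⟩ : ∃ M : ℕ, 1 < M ∧
      0 < Real.log (lowerDilation ω M) / Real.log M := by
    simpa [lowerDilationIndex, lt_iSup_iff] using hi
  have hratio (k : {k : ℕ // 1 ≤ k}) : 0 ≤ ω (M * k) / ω k :=
    div_nonneg (hω.pos (Nat.mul_pos (by lia) k.2)).le (hω.pos k.2).le
  have hlogM : 0 < Real.log M := Real.log_pos (by exact_mod_cast hM)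
  refine ⟨M, lowerDilation ω M, hM,
    (Real.log_pos_iff (Real.iInf_nonneg hratio)).1 ((div_pos_iff_of_pos_right hlogM).1 hlog),
    fun k hk => ?_⟩
  rw [← le_div_iff₀ (hω.pos hk)]
  exact ciInf_le (f := fun k : {k : ℕ // 1 ≤ k} => ω (M * k) / ω k)
    ⟨0, by rintro _ ⟨k, rfl⟩; exact hratio k⟩ ⟨k, hk⟩

lemma exists_le_two_pow_mul (hω : IsDoublingWeight ω) (hi : 0 < lowerDilationIndex ω) (R : ℝ) :
    ∃ l : ℕ, ∀ u, 1 ≤ u → R * ω u ≤ ω (2 ^ l * u) := by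
  obtain ⟨M, φ, hM, hφ, hdil⟩ := hω.exists_dilation hi
  have hMj (j u : ℕ) (hu : 1 ≤ u) : 1 ≤ M ^ j * u := Nat.mul_pos (pow_pos (by lia) j) hu
  have hpow (j u : ℕ) (hu : 1 ≤ u) : φ ^ j * ω u ≤ ω (M ^ j * u) := by
    induction j with
    | zero => simp
    | succ j ih =>
      rw [pow_succ', pow_succ', mul_assoc, mul_assoc]
      exact (mul_le_mul_of_nonneg_left ih (by linarith)).trans (hdil _ (hMj j u hu))
  obtain ⟨j, hj⟩ := pow_unbounded_of_one_lt R hφ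
  refine ⟨M ^ j, fun u hu => ?_⟩
  calc R * ω u ≤ φ ^ j * ω u := mul_le_mul_of_nonneg_right hj.le (hω.pos hu).le
    _ ≤ ω (M ^ j * u) := hpow j u hu
    _ ≤ ω (2 ^ M ^ j * u) :=
      hω.mono (hMj j u hu) (Nat.mul_le_mul_right u Nat.lt_two_pow_self.le)

lemma exists_mul_le (hω : IsDoublingWeight ω) {R : ℕ} (hR : 1 ≤ R) :
    ∃ Θ : ℝ, 0 < Θ ∧ ∀ u, 1 ≤ u → ω (R * u) ≤ Θ * ω u := by
  obtain ⟨θ, hθ, hdouble⟩ := hω.2.2.2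
  have hpow (j u : ℕ) (hu : 1 ≤ u) : ω (2 ^ j * u) ≤ θ ^ j * ω u := by
    induction j with
    | zero => simp
    | succ j ih =>
      rw [pow_succ', pow_succ', mul_assoc, mul_assoc]
      exact (hdouble _ (Nat.mul_pos (by positivity) hu)).trans
        (mul_le_mul_of_nonneg_left ih (by linarith))
  exact ⟨θ ^ R, by positivity, fun u hu => (hω.mono (Nat.mul_pos hR hu)
    (Nat.mul_le_mul_right u Nat.lt_two_pow_self.le)).trans (hpow R u hu)⟩

lemma sum_Ico_rpow_div_le (hω : IsDoublingWeight ω) {r : ℝ} (hr : 0 ≤ r) {M v u : ℕ} (hu : 1 ≤ u)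
    (huM : u ≤ M * (v + 1)) :
    ∑ n ∈ Finset.Ico v u, ω (n + 1) ^ r / ((n + 1 : ℕ) : ℝ) ≤ M * ω u ^ r := by
  have hωu : 0 ≤ ω u ^ r := Real.rpow_nonneg (hω.pos hu).le r
  have hterm (n : ℕ) (hn : n ∈ Finset.Ico v u) :
      ω (n + 1) ^ r / ((n + 1 : ℕ) : ℝ) ≤ ω u ^ r / ((v + 1 : ℕ) : ℝ) := by
    obtain ⟨hvn, hnu⟩ := Finset.mem_Ico.1 hn
    have hωn := (hω.pos (Nat.le_add_left 1 n)).le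
    have hmono := hω.mono (Nat.le_add_left 1 n) hnu
    gcongr
  refine (Finset.sum_le_card_nsmul _ _ _ hterm).trans ?_
  rw [Nat.card_Ico, nsmul_eq_mul, mul_div_left_comm, mul_comm]
  refine mul_le_mul_of_nonneg_right ?_ hωu
  rw [div_le_iff₀ (by positivity)]
  exact_mod_cast (Nat.sub_le u v).trans huM

lemma exists_sum_rpow_div_le (hω : IsDoublingWeight ω) (hi : 0 < lowerDilationIndex ω) {r : ℝ}
    (hr : 0 < r) :
    ∃ D : ℝ, 0 < D ∧ ∀ u, 1 ≤ u →
      ∑ n ∈ Finset.range u, ω (n + 1) ^ r / ((n + 1 : ℕ) : ℝ) ≤ D * ω u ^ r := by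
  obtain ⟨M, φ, hM, hφ, hdil⟩ := hω.exists_dilation hi
  have hφr : 1 < φ ^ r := Real.one_lt_rpow hφ hr
  have hM₀ : 0 < M := zero_lt_one.trans hM
  -- The geometric series with ratio `φ⁻ʳ` sums the contributions of the blocks `(u / M, u]`.
  let D : ℝ := M / (1 - (φ ^ r)⁻¹)
  have hden : 0 < 1 - (φ ^ r)⁻¹ := sub_pos.2 (inv_lt_one_of_one_lt₀ hφr)
  have hD : 0 < D := by positivity
  have hfix : D * (φ ^ r)⁻¹ + M = D := by
    have : D * (1 - (φ ^ r)⁻¹) = M := div_mul_cancel₀ _ hden.ne'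
    linarith
  refine ⟨D, hD, fun u => ?_⟩
  induction u using Nat.strong_induction_on with
  | _ u ih =>
    intro hu
    have hωu := (hω.pos hu).le
    rw [← Finset.sum_range_add_sum_Ico _ (Nat.div_le_self u M), ← hfix, add_mul]
    refine add_le_add ?_ (hω.sum_Ico_rpow_div_le hr.le hu (Nat.lt_mul_div_succ u hM₀).le)
    rcases (u / M).eq_zero_or_pos with h₀ | hv
    · rw [h₀, Finset.sum_range_zero]; positivity
    · have hωv : ω (u / M) ^ r ≤ (φ⁻¹ * ω u) ^ r := by
        refine Real.rpow_le_rpow (hω.pos hv).le ?_ hr.le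
        rw [le_inv_mul_iff₀ (by linarith)]
        exact (hdil _ hv).trans (hω.mono (Nat.mul_pos hM₀ hv) (Nat.mul_div_le u M))
      refine (ih _ (Nat.div_lt_self hu hM) hv).trans ?_
      rw [mul_assoc, ← Real.inv_rpow (by linarith), ← Real.mul_rpow (by positivity) hωu]
      gcongr

end IsDoublingWeight

namespace MBasis

variable {𝕜 X : Type*} [RCLike 𝕜] [AddCommGroup X] [Module 𝕜 X] {N : QuasiNorm 𝕜 X}

section ClassNorm

open MeasureTheory

/-- The measure on `ℕ` with mass `1 / (n + 1)` at `n`. The class norms are built from the `L^q`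
norms of the weighted errors for this measure. -/
noncomputable def logMeasure : Measure ℕ :=
  Measure.count.withDensity fun n => ((n + 1 : ℕ) : ℝ≥0∞)⁻¹

lemma logMeasure_singleton (n : ℕ) : logMeasure {n} = ((n + 1 : ℕ) : ℝ≥0∞)⁻¹ := by
  rw [logMeasure, withDensity_apply _ (measurableSet_singleton n), lintegral_singleton,
    Measure.count_singleton, mul_one]

lemma lintegral_logMeasure (f : ℕ → ℝ≥0∞) :
    ∫⁻ n, f n ∂logMeasure = ∑' n, f n / ((n + 1 : ℕ) : ℝ≥0∞) := by
  simp only [lintegral_countable', logMeasure_singleton, div_eq_mul_inv]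

variable {E F : ℕ → X → ℝ≥0∞} {ω : ℕ → ℝ} {q : ℝ≥0∞} {x : X}

lemma classNorm_eq_add_eLpNorm (N : QuasiNorm 𝕜 X) (E : ℕ → X → ℝ≥0∞) (ω : ℕ → ℝ) (hq : 0 < q)
    (x : X) : classNorm N E ω q x = ENNReal.ofReal (N x) +
      eLpNorm (fun n => ENNReal.ofReal (ω (n + 1)) * E (n + 1) x) q logMeasure := by
  rw [classNorm]
  congr 1
  split_ifs with hqt
  · rw [hqt, eLpNorm_exponent_top, eLpNormEssSup_eq_iSup fun n => ?_]
    · simp only [enorm_eq_self]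
    · rw [logMeasure_singleton]; simp
  · rw [eLpNorm_eq_lintegral_rpow_enorm_toReal hq.ne' hqt, lintegral_logMeasure]
    simp only [enorm_eq_self]

lemma classNorm_le_of_le_mul (N : QuasiNorm 𝕜 X) (hq : 0 < q) {C : ℝ≥0∞} (hC : 1 ≤ C)
    (h : ∀ m, 1 ≤ m → E m x ≤ C * F m x) : classNorm N E ω q x ≤ C * classNorm N F ω q x := by
  rw [classNorm_eq_add_eLpNorm _ _ _ hq, classNorm_eq_add_eLpNorm _ _ _ hq, mul_add]
  refine add_le_add (le_mul_of_one_le_left zero_le hC) ?_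
  refine eLpNorm_le_mul_eLpNorm_of_ae_le_mul'' q
    (measurable_of_countable _).aestronglyMeasurable (.of_forall fun n => ?_)
  rw [enorm_eq_self, enorm_eq_self, mul_left_comm]
  gcongr
  exact h _ n.succ_pos

lemma IsPartiallyGreedy.contEmbeds {B : MBasis N} (hB : B.IsPartiallyGreedy) (ω : ℕ → ℝ)
    (hq : 0 < q) : ContEmbeds (B.partiallyGreedyNorm ω q) (B.greedyNorm ω q) := by
  obtain ⟨C, hC, h⟩ := hB
  have hle (x : X) : B.greedyNorm ω q x ≤ ENNReal.ofReal (C + 1) * B.partiallyGreedyNorm ω q x :=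
    classNorm_le_of_le_mul N hq (ENNReal.one_le_ofReal.2 (by linarith)) fun m hm =>
      (h m hm x).trans (by gcongr; linarith)
  exact ⟨fun x hx => (hle x).trans_lt (ENNReal.mul_lt_top ENNReal.ofReal_lt_top hx),
    C + 1, by linarith, fun x _ => hle x⟩

lemma inv_two_le_logMeasure_Ico {v : ℕ} (hv : 1 ≤ v) : 2⁻¹ ≤ logMeasure (Set.Ico v (2 * v)) := by
  have hmass (n : ℕ) (hn : n ∈ Finset.Ico v (2 * v)) :
      ((2 * v : ℕ) : ℝ≥0∞)⁻¹ ≤ logMeasure {n} := by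
    rw [logMeasure_singleton]
    exact ENNReal.inv_le_inv.2 (Nat.cast_le.2 (Finset.mem_Ico.1 hn).2)
  rw [← Finset.coe_Ico, ← sum_measure_singleton]
  refine le_of_eq_of_le ?_ (Finset.card_nsmul_le_sum _ _ _ hmass)
  have hv₀ : (v : ℝ≥0∞) ≠ 0 := Nat.cast_ne_zero.2 (by lia)
  rw [Nat.card_Ico, show 2 * v - v = v by lia, nsmul_eq_mul, Nat.cast_mul, Nat.cast_two,
    ENNReal.mul_inv (.inl two_ne_zero) (.inr hv₀), mul_left_comm,
    ENNReal.mul_inv_cancel hv₀ (ENNReal.natCast_ne_top v), mul_one]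

lemma exists_le_classNorm (N : QuasiNorm 𝕜 X) (hω : IsDoublingWeight ω) (hq : 0 < q) :
    ∃ c : ℝ, 0 < c ∧ ∀ (E : ℕ → X → ℝ≥0∞) (x : X) (v : ℕ) (s : ℝ), 1 ≤ v →
      (∀ n, 1 ≤ n → n ≤ 2 * v → ENNReal.ofReal s ≤ E n x) →
        ENNReal.ofReal (c * (ω v * s)) ≤ classNorm N E ω q x := by
  refine ⟨2⁻¹ ^ (1 / q.toReal), by positivity, fun E x v s hv hE => ?_⟩
  have hmass := inv_two_le_logMeasure_Ico hv
  have hstep : eLpNorm ((Set.Ico v (2 * v)).indicator fun _ => ENNReal.ofReal (ω v * s)) q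
      logMeasure ≤ eLpNorm (fun n => ENNReal.ofReal (ω (n + 1)) * E (n + 1) x) q logMeasure := by
    refine eLpNorm_mono_enorm fun n => ?_
    simp only [enorm_eq_self, Set.indicator_apply, Set.mem_Ico]
    split_ifs with hn
    · rw [ENNReal.ofReal_mul (hω.pos hv).le]
      gcongr
      · exact hω.mono hv (by lia)
      · exact hE _ n.succ_pos (by lia)
    · exact zero_le
  rw [eLpNorm_indicator_const' measurableSet_Ico
    (((ENNReal.inv_pos.2 ENNReal.ofNat_ne_top).trans_le hmass).ne') hq.ne', enorm_eq_self] at hstep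
  rw [classNorm_eq_add_eLpNorm _ _ _ hq, ENNReal.ofReal_mul (by positivity),
    ← ENNReal.ofReal_rpow_of_nonneg (by positivity) (by positivity), mul_comm]
  refine le_add_left (le_trans ?_ hstep)
  gcongr
  rwa [ENNReal.ofReal_inv_of_pos two_pos, ENNReal.ofReal_ofNat]

lemma eLpNorm_indicator_weight (hω : IsDoublingWeight ω) (hq : 0 < q) (hqt : q ≠ ⊤) (u : ℕ) :
    eLpNorm ((Set.Iio u).indicator fun n => ENNReal.ofReal (ω (n + 1))) q logMeasure =
      ENNReal.ofReal (∑ n ∈ Finset.range u, ω (n + 1) ^ q.toReal / ((n + 1 : ℕ) : ℝ)) ^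
        (1 / q.toReal) := by
  have hr : 0 < q.toReal := ENNReal.toReal_pos hq.ne' hqt
  have hω' (n : ℕ) : 0 ≤ ω (n + 1) := (hω.pos n.succ_pos).le
  have hsupp (n : ℕ) (hn : n ∉ Finset.range u) : ‖(Set.Iio u).indicator
      (fun n => ENNReal.ofReal (ω (n + 1))) n‖ₑ ^ q.toReal / ((n + 1 : ℕ) : ℝ≥0∞) = 0 := by
    rw [Set.indicator_of_notMem (by simpa using hn), enorm_zero, ENNReal.zero_rpow_of_pos hr,
      ENNReal.zero_div]
  rw [eLpNorm_eq_lintegral_rpow_enorm_toReal hq.ne' hqt, lintegral_logMeasure, tsum_eq_sum hsupp,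
    ENNReal.ofReal_sum_of_nonneg fun n _ =>
      div_nonneg (Real.rpow_nonneg (hω' n) _) (Nat.cast_nonneg _)]
  congr 1
  refine Finset.sum_congr rfl fun n hn => ?_
  rw [Set.indicator_of_mem (by simpa using hn), enorm_eq_self,
    ENNReal.ofReal_rpow_of_nonneg (hω' n) hr.le, ENNReal.ofReal_div_of_pos (by positivity),
    ENNReal.ofReal_natCast]

lemma exists_eLpNorm_indicator_weight_le (hω : IsDoublingWeight ω)
    (hi : 0 < lowerDilationIndex ω) (hq : 0 < q) :
    ∃ D : ℝ, 0 < D ∧ ∀ u, 1 ≤ u →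
      eLpNorm ((Set.Iio u).indicator fun n => ENNReal.ofReal (ω (n + 1))) q logMeasure ≤
        ENNReal.ofReal (D * ω u) := by
  rcases eq_or_ne q ⊤ with rfl | hqt
  · refine ⟨1, one_pos, fun u _ => ?_⟩
    rw [one_mul, eLpNorm_exponent_top]
    refine eLpNormEssSup_le_of_ae_enorm_bound (.of_forall fun n => ?_)
    rw [enorm_eq_self]
    refine Set.indicator_apply_le' (fun hn => ?_) fun _ => zero_le
    exact ENNReal.ofReal_le_ofReal (hω.mono n.succ_pos hn)
  · have hr : 0 < q.toReal := ENNReal.toReal_pos hq.ne' hqt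
    obtain ⟨D, hD, hsum⟩ := hω.exists_sum_rpow_div_le hi hr
    refine ⟨D ^ (1 / q.toReal), by positivity, fun u hu => ?_⟩
    have hωu := (hω.pos hu).le
    calc eLpNorm ((Set.Iio u).indicator fun n => ENNReal.ofReal (ω (n + 1))) q logMeasure
        ≤ ENNReal.ofReal (D * ω u ^ q.toReal) ^ (1 / q.toReal) := by
          rw [eLpNorm_indicator_weight hω hq hqt]
          gcongr
          exact hsum u hu
      _ = ENNReal.ofReal (D ^ (1 / q.toReal) * ω u) := by
          rw [ENNReal.ofReal_rpow_of_nonneg (by positivity) (by positivity),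
            Real.mul_rpow hD.le (by positivity), ← Real.rpow_mul hωu, mul_one_div_cancel hr.ne',
            Real.rpow_one]

lemma weight_mul_error_le_step {r : ℕ → ℝ≥0∞} {a b : ℝ≥0∞} {u U : ℕ}
    (hru : ∀ n, 1 ≤ n → n ≤ u → r n ≤ a) (hrU : ∀ n, u < n → n ≤ U → r n ≤ b)
    (hr₀ : ∀ n, U < n → r n = 0) (n : ℕ) :
    ENNReal.ofReal (ω (n + 1)) * r (n + 1) ≤
      a * (Set.Iio u).indicator (fun n => ENNReal.ofReal (ω (n + 1))) n +
        b * (Set.Iio U).indicator (fun n => ENNReal.ofReal (ω (n + 1))) n := by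
  rcases lt_or_ge n u with hnu | hun
  · rw [Set.indicator_of_mem (Set.mem_Iio.2 hnu), mul_comm]
    refine le_add_right ?_
    gcongr
    exact hru _ n.succ_pos hnu
  rcases lt_or_ge n U with hnU | hUn
  · rw [Set.indicator_of_mem (Set.mem_Iio.2 hnU), mul_comm]
    refine le_add_left ?_
    gcongr
    exact hrU _ (Nat.lt_succ_of_le hun) hnU
  · simp [hr₀ (n + 1) (Nat.lt_succ_of_le hUn)]

lemma exists_eLpNorm_weight_mul_error_le (hω : IsDoublingWeight ω)
    (hi : 0 < lowerDilationIndex ω) (hq : 0 < q) :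
    ∃ D : ℝ, 0 < D ∧ ∀ (r : ℕ → ℝ≥0∞) (u U : ℕ) (a b : ℝ), 1 ≤ u → u ≤ U →
      0 ≤ a → 0 ≤ b → (∀ n, 1 ≤ n → n ≤ u → r n ≤ ENNReal.ofReal a) →
      (∀ n, u < n → n ≤ U → r n ≤ ENNReal.ofReal b) → (∀ n, U < n → r n = 0) →
        eLpNorm (fun n => ENNReal.ofReal (ω (n + 1)) * r (n + 1)) q logMeasure ≤
          ENNReal.ofReal (D * (ω u * a + ω U * b)) := by
  obtain ⟨D, hD, hinit⟩ := exists_eLpNorm_indicator_weight_le hω hi hq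
  let W (v : ℕ) : ℕ → ℝ≥0∞ := (Set.Iio v).indicator fun n => ENNReal.ofReal (ω (n + 1))
  let L := (ENNReal.LpAddConst q).toReal
  refine ⟨(L + 1) * D, by positivity, fun r u U a b hu huU ha hb hru hrU hr₀ => ?_⟩
  have hωu := (hω.pos hu).le
  have hωU := (hω.pos (hu.trans huU)).le
  have hW (v : ℕ) (c : ℝ≥0∞) (hv : 1 ≤ v) :
      eLpNorm (fun n => c * W v n) q logMeasure ≤ c * ENNReal.ofReal (D * ω v) :=
    (eLpNorm_le_mul_eLpNorm_of_ae_le_mul'' (c := c) (g := W v) q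
      (measurable_of_countable _).aestronglyMeasurable (.of_forall fun _ => le_rfl)).trans
      (by gcongr; exact hinit v hv)
  calc eLpNorm (fun n => ENNReal.ofReal (ω (n + 1)) * r (n + 1)) q logMeasure
      ≤ eLpNorm ((fun n => ENNReal.ofReal a * W u n) + fun n => ENNReal.ofReal b * W U n) q
          logMeasure := eLpNorm_mono_enorm (weight_mul_error_le_step hru hrU hr₀)
    _ ≤ ENNReal.ofReal (L + 1) * (ENNReal.ofReal a * ENNReal.ofReal (D * ω u) +
          ENNReal.ofReal b * ENNReal.ofReal (D * ω U)) := by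
        refine (eLpNorm_add_le' (measurable_of_countable _).aestronglyMeasurable
          (measurable_of_countable _).aestronglyMeasurable q).trans ?_
        gcongr
        · exact ENNReal.le_ofReal_iff_toReal_le (ENNReal.LpAddConst_lt_top q).ne (by positivity)
            |>.2 (le_add_of_nonneg_right zero_le_one)
        · exact hW u _ hu
        · exact hW U _ (hu.trans huU)
    _ = ENNReal.ofReal ((L + 1) * D * (ω u * a + ω U * b)) := by
        rw [← ENNReal.ofReal_mul ha, ← ENNReal.ofReal_mul hb,
          ← ENNReal.ofReal_add (by positivity) (by positivity),
          ← ENNReal.ofReal_mul (by positivity)]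
        congr 1
        ring

lemma exists_classNorm_le (N : QuasiNorm 𝕜 X) (hω : IsDoublingWeight ω)
    (hi : 0 < lowerDilationIndex ω) (hq : 0 < q) :
    ∃ D : ℝ, 0 < D ∧ ∀ (E : ℕ → X → ℝ≥0∞) (x : X) (u U : ℕ) (a b : ℝ), 1 ≤ u → u ≤ U →
      0 ≤ b → N x ≤ a → (∀ n, 1 ≤ n → n ≤ u → E n x ≤ ENNReal.ofReal a) →
      (∀ n, u < n → n ≤ U → E n x ≤ ENNReal.ofReal b) → (∀ n, U < n → E n x = 0) →
        classNorm N E ω q x ≤ ENNReal.ofReal (D * (ω u * a + ω U * b)) := by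
  obtain ⟨D, hD, herror⟩ := exists_eLpNorm_weight_mul_error_le hω hi hq
  have hω₁ := hω.1
  refine ⟨(ω 1)⁻¹ + D, by positivity, fun E x u U a b hu huU hb hx hEu hEU hE₀ => ?_⟩
  have ha : 0 ≤ a := (N.nonneg x).trans hx
  have hωu := (hω.pos hu).le
  have hωU := (hω.pos (hu.trans huU)).le
  have hNx : N x ≤ (ω 1)⁻¹ * (ω u * a + ω U * b) := by
    rw [le_inv_mul_iff₀ hω₁]
    calc ω 1 * N x ≤ ω u * a := mul_le_mul (hω.mono le_rfl hu) hx (N.nonneg x) hωu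
      _ ≤ ω u * a + ω U * b := le_add_of_nonneg_right (by positivity)
  rw [classNorm_eq_add_eLpNorm _ _ _ hq, add_mul,
    ENNReal.ofReal_add (by positivity) (by positivity)]
  exact add_le_add (ENNReal.ofReal_le_ofReal hNx)
    (herror (E · x) u U a b hu huU ha hb hEu hEU hE₀)

end ClassNorm

section Democracy

variable {B : MBasis N} {C : ℝ}

lemma hl_le_hRr (B : MBasis N) (m u : ℕ) : B.hl m ≤ B.hRr m u :=
  le_iInf fun A => le_iInf fun ε => le_iInf fun h =>
    iInf_le_of_le A (iInf_le_of_le ε (iInf_le_of_le ⟨h.1.ge, h.2.2⟩ le_rfl))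

lemma hRr_le (B : MBasis N) {A : Finset ℕ} {ε : ℕ → 𝕜} {u : ℕ} (hu : ∀ n ∈ A, u ≤ n)
    (hε : ∀ n ∈ A, ‖ε n‖ = 1) : B.hRr A.card u ≤ ENNReal.ofReal (N (B.indicatorSum ε A)) :=
  iInf_le_of_le A (iInf_le_of_le ε (iInf_le_of_le ⟨rfl, hu, hε⟩ le_rfl))

lemma le_hRl (B : MBasis N) {A : Finset ℕ} {ε : ℕ → 𝕜} {u : ℕ} (hu : ∀ n ∈ A, n < u)
    (hε : ∀ n ∈ A, ‖ε n‖ = 1) : ENNReal.ofReal (N (B.indicatorSum ε A)) ≤ B.hRl A.card u :=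
  le_iSup_of_le A (le_iSup_of_le ε (le_iSup_of_le ⟨rfl, hu, hε⟩ le_rfl))

lemma hRr_mono_right (B : MBasis N) (m : ℕ) : Monotone (B.hRr m) := fun _ _ huv =>
  le_iInf fun _ => le_iInf fun _ => le_iInf fun h =>
    h.1 ▸ B.hRr_le (fun n hn => huv.trans (h.2.1 n hn)) h.2.2

lemma GreedyProjBound.hRl_le (h : B.GreedyProjBound C) (m u : ℕ) :
    B.hRl m u ≤ ENNReal.ofReal C * B.hRl u u := by
  refine iSup_le fun A => iSup_le fun ε => iSup_le fun ⟨_, hAu, hε⟩ => ?_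
  have hη (n : ℕ) : ‖A.piecewise ε 1 n‖ = 1 := by
    by_cases hn : n ∈ A
    · rw [A.piecewise_eq_of_mem _ _ hn, hε n hn]
    · rw [A.piecewise_eq_of_notMem _ _ hn, Pi.one_apply, norm_one]
  rw [B.indicatorSum_congr fun n hn => (A.piecewise_eq_of_mem ε 1 hn).symm]
  calc ENNReal.ofReal (N (B.indicatorSum (A.piecewise ε 1) A))
      ≤ ENNReal.ofReal (C * N (B.indicatorSum (A.piecewise ε 1) (Finset.range u))) :=
        ENNReal.ofReal_le_ofReal <|
          h.indicator_le (fun n hn => Finset.mem_range.2 (hAu n hn)) fun n _ => hη n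
    _ = ENNReal.ofReal C *
          ENNReal.ofReal (N (B.indicatorSum (A.piecewise ε 1) (Finset.range u))) :=
        ENNReal.ofReal_mul (zero_le_one.trans h.one_le)
    _ ≤ ENNReal.ofReal C * B.hRl u u := by
        gcongr
        simpa only [Finset.card_range] using
          B.le_hRl (fun n hn => Finset.mem_range.1 hn) fun n _ => hη n

lemma IsCharacteristic.exists_hRl_le {ψ : ℕ → ℕ} (hψ : B.IsCharacteristic ψ) {K : ℝ≥0∞}
    (hK : K ≠ ⊤)
    (hnear : ∀ m u, 1 ≤ m → m ≤ u → u ≤ ψ m → B.hRl m u ≤ K * B.hRr m u) :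
    ∃ K' : ℝ≥0∞, K' ≠ ⊤ ∧ ∀ m u, 1 ≤ m → m ≤ u → B.hRl m u ≤ K' * B.hRr m u := by
  obtain ⟨hle, c, -, hchar⟩ := hψ
  refine ⟨max K (ENNReal.ofReal c * K),
    (max_lt hK.lt_top (ENNReal.mul_lt_top ENNReal.ofReal_lt_top hK.lt_top)).ne,
    fun m u hm hmu => ?_⟩
  rcases le_total u (ψ m) with hu | hu
  · exact (hnear m u hm hmu hu).trans (by gcongr; exact le_max_left ..)
  · calc B.hRl m u ≤ ⨆ (u : ℕ) (_ : m ≤ u), B.hRl m u := le_iSup₂_of_le u hmu le_rfl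
      _ ≤ ENNReal.ofReal c * (K * B.hRr m (ψ m)) :=
        (hchar m hm).trans (by gcongr; exact hnear m _ hm (hle m hm) le_rfl)
      _ ≤ max K (ENNReal.ofReal c * K) * B.hRr m u := by
        rw [← mul_assoc]
        gcongr
        · exact le_max_right ..
        · exact B.hRr_mono_right m hu

lemma isSuperConservative_of_hRl_le {K : ℝ≥0∞} (hK : K ≠ ⊤)
    (h : ∀ m u, 1 ≤ m → m ≤ u → B.hRl m u ≤ K * B.hRr m u) : B.IsSuperConservative := by
  refine ⟨K.toReal, ENNReal.toReal_nonneg, fun A D ε δ hcard hAD hε hδ => ?_⟩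
  rcases A.eq_empty_or_nonempty with rfl | hA
  · simpa [indicatorSum, N.map_zero] using mul_nonneg ENNReal.toReal_nonneg (N.nonneg _)
  let u := A.max' hA + 1
  have hAu (n : ℕ) (hn : n ∈ A) : n < u := Nat.lt_succ_of_le (A.le_max' n hn)
  have hmu : A.card ≤ u := by
    simpa using Finset.card_le_card fun n hn => Finset.mem_range.2 (hAu n hn)
  have hle : ENNReal.ofReal (N (B.indicatorSum ε A)) ≤
      K * ENNReal.ofReal (N (B.indicatorSum δ D)) :=
    calc ENNReal.ofReal (N (B.indicatorSum ε A)) ≤ K * B.hRr A.card u :=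
          (B.le_hRl hAu hε).trans (h _ u hA.card_pos hmu)
      _ ≤ K * ENNReal.ofReal (N (B.indicatorSum δ D)) := by
          rw [hcard]
          gcongr
          exact B.hRr_le (hAD _ (A.max'_mem hA)) hδ
  rwa [← ENNReal.ofReal_toReal hK, ← ENNReal.ofReal_mul ENNReal.toReal_nonneg,
    ENNReal.ofReal_le_ofReal_iff (mul_nonneg ENNReal.toReal_nonneg (N.nonneg _))] at hle

lemma PropertyI.exists_hRr_two_pow_mul_le (hI : B.PropertyI) (l : ℕ) :
    ∃ K : ℝ≥0∞, K ≠ ⊤ ∧ ∀ u, 1 ≤ u → B.hRr (2 ^ l * u) u ≤ K * B.hRr u u := by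
  let S := ⨆ (l : ℕ) (u : ℕ) (_ : 1 ≤ u), B.hRr (2 ^ (l + 1) * u) u / B.hRr (2 ^ l * u) u
  -- `S` may vanish, and then `S * ⊤` is not an upper bound for `hRr`.
  have hS : S + 1 ≠ ⊤ := ENNReal.add_ne_top.2 ⟨hI.1.ne, ENNReal.one_ne_top⟩
  have hstep (l u : ℕ) (hu : 1 ≤ u) :
      B.hRr (2 ^ (l + 1) * u) u ≤ (S + 1) * B.hRr (2 ^ l * u) u := by
    refine (ENNReal.div_le_iff_le_mul (.inr hS) (.inr (by simp))).1 ?_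
    exact le_add_right (le_iSup_of_le l (le_iSup₂_of_le u hu le_rfl))
  refine ⟨(S + 1) ^ l, ENNReal.pow_ne_top hS, fun u hu => ?_⟩
  induction l with
  | zero => simp
  | succ l ih =>
    rw [pow_succ' (S + 1), mul_assoc]
    exact (hstep l u hu).trans (by gcongr)

lemma PropertyWStar.exists_right_indicator_le (hW : B.PropertyWStar) (h : B.GreedyProjBound C)
    {R : ℕ} (hR : 1 ≤ R) :
    ∃ (T : ℕ) (K : ℝ), 1 ≤ T ∧ ∀ u, 1 ≤ u → ∃ (D : Finset ℕ) (δ : ℕ → 𝕜),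
      (∀ n ∈ D, u ≤ n ∧ n < T * u) ∧ (∀ n ∈ D, ‖δ n‖ = 1) ∧ R * u ≤ D.card + u ∧
        ENNReal.ofReal (N (B.indicatorSum δ D)) ≤ ENNReal.ofReal K * B.hl (R * u) := by
  obtain ⟨C₁, C₂, hC₁, -, hW⟩ := hW
  have hC := zero_le_one.trans h.one_le
  refine ⟨⌈C₁⌉₊ * R, C * C₂, Nat.mul_pos (Nat.ceil_pos.2 hC₁) hR, fun u hu => ?_⟩
  obtain ⟨A, δ, hcard, hAC, hδ, hA⟩ := hW (R * u) (Nat.mul_pos hR hu)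
  refine ⟨A \ Finset.range u, δ, fun n hn => ?_, fun n hn => hδ n (Finset.mem_sdiff.1 hn).1, ?_, ?_⟩
  · obtain ⟨hnA, hnu⟩ := Finset.mem_sdiff.1 hn
    have hlt : (n : ℝ) + 1 ≤ ⌈C₁⌉₊ * (R * u : ℕ) :=
      (hAC n hnA).trans (by gcongr; exact Nat.le_ceil C₁)
    rw [mul_assoc]
    exact ⟨not_lt.1 fun hlt => hnu (Finset.mem_range.2 hlt), by exact_mod_cast hlt⟩
  · have hsdiff := Finset.le_card_sdiff (Finset.range u) A
    rw [hcard, Finset.card_range] at hsdiff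
    lia
  · calc ENNReal.ofReal (N (B.indicatorSum δ (A \ Finset.range u)))
        ≤ ENNReal.ofReal C * ENNReal.ofReal (N (B.indicatorSum δ A)) := by
          rw [← ENNReal.ofReal_mul hC]
          exact ENNReal.ofReal_le_ofReal (h.indicator_le Finset.sdiff_subset hδ)
      _ ≤ ENNReal.ofReal (C * C₂) * B.hl (R * u) := by
          rw [ENNReal.ofReal_mul hC, mul_assoc]
          gcongr

end Democracy

section TestVectors

variable {B : MBasis N} {C : ℝ} {ω : ℕ → ℝ} {q : ℝ≥0∞}

lemma IsSchauder.exists_tail_le (hS : B.IsSchauder) :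
    ∃ C : ℝ, 1 ≤ C ∧ ∀ m x, 1 ≤ m → N (x - B.partialSum m x) ≤ C * N x := by
  obtain ⟨C, hC, h⟩ := hS
  have hκ := N.one_le_modulus
  refine ⟨N.modulus * (1 + C), by nlinarith, fun m x hm => ?_⟩
  rw [mul_assoc, one_add_mul]
  exact N.sub_le_of_le le_rfl (h m hm x)

lemma sub_partialSum_indicatorSum (B : MBasis N) (a : ℕ → 𝕜) (A : Finset ℕ) (m : ℕ) :
    B.indicatorSum a A - B.partialSum m (B.indicatorSum a A) =
      B.indicatorSum a (A \ Finset.range m) := by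
  have h : B.partialSum m (B.indicatorSum a A) = B.indicatorSum a (A ∩ Finset.range m) := by
    simp only [partialSum, coord_indicatorSum, ite_smul, zero_smul]
    rw [← Finset.sum_filter, Finset.filter_mem_eq_inter, Finset.inter_comm, indicatorSum]
  rw [h, ← B.indicatorSum_sdiff a Finset.inter_subset_left, Finset.sdiff_inter_self_left]

lemma beta_indicatorSum (B : MBasis N) (a : ℕ → 𝕜) (A : Finset ℕ) (m : ℕ) :
    B.beta m (B.indicatorSum a A) =
      ENNReal.ofReal (N (B.indicatorSum a (A \ Finset.range m))) := by
  rw [beta, sub_partialSum_indicatorSum]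

lemma beta_indicatorSum_of_subset_range (B : MBasis N) (a : ℕ → 𝕜) {A : Finset ℕ} {m : ℕ}
    (hA : A ⊆ Finset.range m) : B.beta m (B.indicatorSum a A) = 0 := by
  rw [beta_indicatorSum, Finset.sdiff_eq_empty_iff_subset.2 hA, indicatorSum, Finset.sum_empty,
    N.map_zero, ENNReal.ofReal_zero]

lemma beta_indicatorSum_range_union (B : MBasis N) (a : ℕ → 𝕜) (D : Finset ℕ) {u m : ℕ}
    (hum : u ≤ m) :
    B.beta m (B.indicatorSum a (Finset.range u ∪ D)) = B.beta m (B.indicatorSum a D) := by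
  rw [beta_indicatorSum, beta_indicatorSum, Finset.union_sdiff_distrib,
    Finset.sdiff_eq_empty_iff_subset.2 (Finset.range_mono hum), Finset.empty_union]

lemma exists_indicatorSum_eq_and_eq (B : MBasis N) {A D : Finset ℕ} (hAD : Disjoint A D)
    {ε δ : ℕ → 𝕜} (hε : ∀ n ∈ A, ‖ε n‖ = 1) (hδ : ∀ n ∈ D, ‖δ n‖ = 1) :
    ∃ η : ℕ → 𝕜, (∀ n ∈ A ∪ D, ‖η n‖ = 1) ∧ B.indicatorSum η A = B.indicatorSum ε A ∧
      B.indicatorSum η D = B.indicatorSum δ D := by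
  have hA (n : ℕ) (hn : n ∈ A) := A.piecewise_eq_of_mem ε δ hn
  have hD (n : ℕ) (hn : n ∈ D) := A.piecewise_eq_of_notMem ε δ (Finset.disjoint_right.1 hAD hn)
  refine ⟨A.piecewise ε δ, fun n hn => ?_, B.indicatorSum_congr hA, B.indicatorSum_congr hD⟩
  rcases Finset.mem_union.1 hn with hn | hn
  · rw [hA n hn, hε n hn]
  · rw [hD n hn, hδ n hn]

lemma IsSchauder.exists_partiallyGreedyNorm_le (hS : B.IsSchauder) (hω : IsDoublingWeight ω)
    (hi : 0 < lowerDilationIndex ω) (hq : 0 < q) :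
    ∃ K : ℝ, 0 < K ∧ ∀ (u U : ℕ) (a : ℕ → 𝕜) (D : Finset ℕ), 1 ≤ u → u ≤ U →
      (∀ n ∈ D, u ≤ n ∧ n < U) →
        B.partiallyGreedyNorm ω q (B.indicatorSum a (Finset.range u ∪ D)) ≤
          ENNReal.ofReal (K * (ω u * N (B.indicatorSum a (Finset.range u)) +
            ω U * N (B.indicatorSum a D))) := by
  obtain ⟨C, hC, htail⟩ := hS.exists_tail_le
  obtain ⟨K, hK, hclass⟩ := exists_classNorm_le N hω hi hq
  have hκ := N.one_le_modulus
  refine ⟨K * (2 * (C * N.modulus)), by positivity, fun u U a D hu huU hD => ?_⟩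
  let x := B.indicatorSum a (Finset.range u ∪ D)
  let P := N (B.indicatorSum a (Finset.range u))
  let R := N (B.indicatorSum a D)
  have hP : 0 ≤ P := N.nonneg _
  have hR : 0 ≤ R := N.nonneg _
  have hdisj : Disjoint (Finset.range u) D := Finset.disjoint_right.2 fun n hn hnu =>
    (Finset.mem_range.1 hnu).not_ge (hD n hn).1
  have hx : N x ≤ N.modulus * (P + R) := by
    simp only [x, B.indicatorSum_union hdisj]
    exact N.add_le_modulus _ _
  have hbeta (n : ℕ) (hn : 1 ≤ n) (y : X) : B.beta n y ≤ ENNReal.ofReal (C * N y) :=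
    ENNReal.ofReal_le_ofReal (htail n y hn)
  have hbound : B.partiallyGreedyNorm ω q x ≤
      ENNReal.ofReal (K * (ω u * (C * (N.modulus * (P + R))) + ω U * (C * R))) := by
    refine hclass B.beta x u U _ _ hu huU (by positivity)
      (hx.trans (le_mul_of_one_le_left (by positivity) hC)) (fun n hn _ => ?_)
      (fun n hun _ => ?_) fun n hUn => ?_
    · exact (hbeta n hn x).trans (ENNReal.ofReal_le_ofReal (by gcongr))
    · exact (B.beta_indicatorSum_range_union a D hun.le).trans_le (hbeta n (hu.trans hun.le) _)
    · exact B.beta_indicatorSum_of_subset_range a <|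
        Finset.union_subset (Finset.range_mono (huU.trans hUn.le)) fun k hk =>
          Finset.mem_range.2 ((hD k hk).2.trans hUn)
  refine hbound.trans (ENNReal.ofReal_le_ofReal ?_)
  have hωu := (hω.pos hu).le
  have hωuU := hω.mono hu huU
  rw [mul_assoc K]
  gcongr
  calc ω u * (C * (N.modulus * (P + R))) + ω U * (C * R)
      ≤ C * N.modulus * (ω u * P + ω U * R + ω U * R) := by
        have hωR : ω u * R ≤ ω U * R := by gcongr
        have hωκ : ω U * R ≤ N.modulus * (ω U * R) := le_mul_of_one_le_left (by nlinarith) hκ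
        nlinarith [mul_le_mul_of_nonneg_left hωR (by positivity : 0 ≤ C * N.modulus)]
    _ ≤ 2 * (C * N.modulus) * (ω u * P + ω U * R) := by
        have hωP : 0 ≤ C * N.modulus * (ω u * P) := by positivity
        linarith

lemma GreedyProjBound.exists_le_greedyNorm (h : B.GreedyProjBound C) (hω : IsDoublingWeight ω)
    (hq : 0 < q) :
    ∃ c : ℝ, 0 < c ∧ ∀ (v : ℕ) (ε : ℕ → 𝕜) (A D : Finset ℕ), 1 ≤ v → Disjoint A D →
      (∀ n ∈ A ∪ D, ‖ε n‖ = 1) → 2 * v ≤ D.card →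
        ENNReal.ofReal (c * (ω v * N (B.indicatorSum ε A))) ≤
          B.greedyNorm ω q (B.indicatorSum ε (A ∪ D)) := by
  obtain ⟨c, hc, hclass⟩ := exists_le_classNorm N hω hq
  have hC := one_pos.trans_le h.one_le
  refine ⟨c * C⁻¹, by positivity, fun v ε A D hv hAD hε hvD => ?_⟩
  rw [mul_assoc, mul_left_comm C⁻¹]
  refine hclass B.gamma _ v _ hv fun n _ hn => ?_
  obtain ⟨G, hGD, rfl⟩ := Finset.exists_subset_card_eq (hn.trans hvD)
  have hGA : G ⊆ A ∪ D := hGD.trans Finset.subset_union_right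
  have hgreedy : B.IsGreedySet (B.indicatorSum ε (A ∪ D)) G :=
    isGreedySet_indicatorSum hGA fun n hn k hk => by
      rw [hε n (hGA hn), hε k (Finset.sdiff_subset hk)]
  refine le_trans (ENNReal.ofReal_le_ofReal ?_) (gamma_le_iff.1 le_rfl G hgreedy rfl)
  rw [B.coordProj_indicatorSum ε hGA, ← B.indicatorSum_sdiff ε hGA, inv_mul_le_iff₀ hC]
  exact h.indicator_le (Finset.subset_sdiff.2 ⟨Finset.subset_union_left, hAD.mono_right hGD⟩)
    fun n hn => hε n (Finset.sdiff_subset hn)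

lemma exists_weight_mul_initial_le_of_contEmbeds (hω : IsDoublingWeight ω)
    (hi : 0 < lowerDilationIndex ω) (h : B.GreedyProjBound C) (hS : B.IsSchauder) (hq : 0 < q)
    (hemb : ContEmbeds (B.partiallyGreedyNorm ω q) (B.greedyNorm ω q)) :
    ∃ K : ℝ, 0 < K ∧ ∀ (u U v : ℕ) (ε δ : ℕ → 𝕜) (D : Finset ℕ), 1 ≤ u → u ≤ U → 1 ≤ v →
      (∀ n ∈ Finset.range u, ‖ε n‖ = 1) → (∀ n ∈ D, ‖δ n‖ = 1) →
      (∀ n ∈ D, u ≤ n ∧ n < U) → 2 * v ≤ D.card →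
        ω v * N (B.indicatorSum ε (Finset.range u)) ≤
          K * (ω u * N (B.indicatorSum ε (Finset.range u)) + ω U * N (B.indicatorSum δ D)) := by
  obtain ⟨-, M, hM, hemb⟩ := hemb
  obtain ⟨K, hK, hupper⟩ := hS.exists_partiallyGreedyNorm_le hω hi hq
  obtain ⟨c, hc, hlower⟩ := h.exists_le_greedyNorm hω hq
  refine ⟨c⁻¹ * (M * K), by positivity, fun u U v ε δ D hu huU hv hε hδ hD hvD => ?_⟩
  have hdisj : Disjoint (Finset.range u) D := Finset.disjoint_right.2 fun n hn hnu =>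
    (Finset.mem_range.1 hnu).not_ge (hD n hn).1
  obtain ⟨η, hη, hηu, hηD⟩ := B.exists_indicatorSum_eq_and_eq hdisj hε hδ
  rw [← hηu, ← hηD, mul_assoc, le_inv_mul_iff₀ hc, mul_assoc]
  have hωu := hω.pos hu
  have hωU := hω.pos (hu.trans huU)
  have hpos := N.nonneg (B.indicatorSum η (Finset.range u))
  have hpos' := N.nonneg (B.indicatorSum η D)
  refine (ENNReal.ofReal_le_ofReal_iff (by positivity)).1 ?_
  have hpg := hupper u U η D hu huU hD
  rw [ENNReal.ofReal_mul hM.le]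
  exact (hlower v η _ D hv hdisj hη hvD).trans
    ((hemb _ (hpg.trans_lt ENNReal.ofReal_lt_top)).trans (by gcongr))

lemma exists_hRl_self_le_of_contEmbeds (hω : IsDoublingWeight ω)
    (hi : 0 < lowerDilationIndex ω) (h : B.GreedyProjBound C) (hS : B.IsSchauder)
    (hI : B.PropertyI) (hW : B.PropertyWStar) (hq : 0 < q)
    (hemb : ContEmbeds (B.partiallyGreedyNorm ω q) (B.greedyNorm ω q)) :
    ∃ K : ℝ≥0∞, K ≠ ⊤ ∧ ∀ u, 1 ≤ u → B.hRl u u ≤ K * B.hRr u u := by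
  obtain ⟨K, hK, htest⟩ := exists_weight_mul_initial_le_of_contEmbeds hω hi h hS hq hemb
  -- With `ω (2^l u) ≥ 2 K ω u` the term `K ω u ‖1_{ε[1,u]}‖` of the test inequality is absorbed.
  obtain ⟨l, hl⟩ := hω.exists_le_two_pow_mul hi (2 * K)
  obtain ⟨L, hL, hIl⟩ := hI.exists_hRr_two_pow_mul_le (l + 2)
  obtain ⟨T, K', hT, hright⟩ := hW.exists_right_indicator_le h (R := 2 ^ (l + 2)) Nat.one_le_two_pow
  obtain ⟨Θ, hΘ, hdouble⟩ := hω.exists_mul_le hT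
  refine ⟨ENNReal.ofReal Θ * (ENNReal.ofReal K' * L), by finiteness, fun u hu => ?_⟩
  obtain ⟨D, δ, hD, hδ, hcard, hδD⟩ := hright u hu
  refine iSup_le fun A => iSup_le fun ε => iSup_le fun ⟨hA, hAu, hε⟩ => ?_
  obtain rfl : A = Finset.range u := Finset.eq_of_subset_of_card_le
    (fun n hn => Finset.mem_range.2 (hAu n hn)) (by rw [hA, Finset.card_range])
  have hv : u ≤ 2 ^ l * u := Nat.le_mul_of_pos_left u (by positivity)
  have hle : N (B.indicatorSum ε (Finset.range u)) ≤ Θ * N (B.indicatorSum δ D) := by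
    have hωu := hω.pos hu
    have hmain := htest u (T * u) (2 ^ l * u) ε δ D hu (Nat.le_mul_of_pos_left u hT)
      (hu.trans hv) hε hδ hD (by rw [pow_add] at hcard; lia)
    have habsorb := mul_le_mul_of_nonneg_right (hl u hu)
      (N.nonneg (B.indicatorSum ε (Finset.range u)))
    have hdouble' := mul_le_mul_of_nonneg_right (hdouble u hu) (N.nonneg (B.indicatorSum δ D))
    refine le_of_mul_le_mul_left ?_ (mul_pos hK hωu)
    nlinarith [mul_le_mul_of_nonneg_left hdouble' hK.le]
  calc ENNReal.ofReal (N (B.indicatorSum ε (Finset.range u)))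
      ≤ ENNReal.ofReal Θ * ENNReal.ofReal (N (B.indicatorSum δ D)) := by
        rw [← ENNReal.ofReal_mul hΘ.le]
        exact ENNReal.ofReal_le_ofReal hle
    _ ≤ ENNReal.ofReal Θ * (ENNReal.ofReal K' * (L * B.hRr u u)) := by
        gcongr
        exact hδD.trans (by gcongr; exact (B.hl_le_hRr _ u).trans (hIl u hu))
    _ = ENNReal.ofReal Θ * (ENNReal.ofReal K' * L) * B.hRr u u := by simp only [mul_assoc]

lemma isSuperConservative_of_contEmbeds (hω : IsDoublingWeight ω)
    (hi : 0 < lowerDilationIndex ω) (hB : B.IsQuasiGreedy) (hS : B.IsSchauder)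
    (hI : B.PropertyI) (hW : B.PropertyWStar) (hq : 0 < q)
    (hemb : ContEmbeds (B.partiallyGreedyNorm ω q) (B.greedyNorm ω q)) :
    B.IsSuperConservative := by
  obtain ⟨C, h⟩ := hB.exists_greedyProjBound
  obtain ⟨K, hK, hinit⟩ := exists_hRl_self_le_of_contEmbeds hω hi h hS hI hW hq hemb
  obtain ⟨-, ψ, hψ, C', -, hreg⟩ := hI
  obtain ⟨K', hK', hle⟩ := hψ.exists_hRl_le (K := ENNReal.ofReal C * (K * ENNReal.ofReal C'))
    (by finiteness) fun m u hm hmu huψ => by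
      have hu := hm.trans hmu
      calc B.hRl m u ≤ ENNReal.ofReal C * (K * (ENNReal.ofReal C' * B.hRr m u)) :=
            (h.hRl_le m u).trans
              (by gcongr; exact (hinit u hu).trans (by gcongr; exact hreg m u hm hu huψ))
        _ = ENNReal.ofReal C * (K * ENNReal.ofReal C') * B.hRr m u := by simp only [mul_assoc]
  exact isSuperConservative_of_hRl_le hK' hle

end TestVectors

end MBasis

end GreedyApprox

theorem theorem1p5_general {𝕜 X : Type*} [RCLike 𝕜] [AddCommGroup X] [Module 𝕜 X]
    {N : GreedyApprox.QuasiNorm 𝕜 X} (ω : ℕ → ℝ) (B : GreedyApprox.MBasis N) :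
    (B.IsPartiallyGreedy →
      ∀ q : ℝ≥0∞, 0 < q →
        GreedyApprox.ContEmbeds (B.partiallyGreedyNorm ω q) (B.greedyNorm ω q)) ∧
    (GreedyApprox.IsDoublingWeight ω → 0 < GreedyApprox.lowerDilationIndex ω →
      B.IsQuasiGreedy → B.IsSchauder → B.PropertyI → B.PropertyWStar →
      (∃ q : ℝ≥0∞, 0 < q ∧
        GreedyApprox.ContEmbeds (B.partiallyGreedyNorm ω q) (B.greedyNorm ω q)) →
      B.IsPartiallyGreedy) := by
  refine ⟨fun hpg q hq => hpg.contEmbeds ω hq, fun hω hi hB hS hI hW ⟨q, hq, hemb⟩ => ?_⟩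
  exact (GreedyApprox.MBasis.isSuperConservative_of_contEmbeds hω hi hB hS hI hW hq
    hemb).isPartiallyGreedy hB

theorem theorem1p5 {𝕜 X : Type*} [RCLike 𝕜] [AddCommGroup X] [Module 𝕜 X]
    (N : GreedyApprox.QuasiNorm 𝕜 X) (hN : N.IsComplete)
    (ω : ℕ → ℝ) (hω : GreedyApprox.IsDoublingWeight ω)
    (hi : 0 < GreedyApprox.lowerDilationIndex ω)
    (B : GreedyApprox.MBasis N) (hB : B.IsQuasiGreedy) :
    (B.IsPartiallyGreedy →
      ∀ q : ℝ≥0∞, 0 < q →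
        GreedyApprox.ContEmbeds (B.partiallyGreedyNorm ω q) (B.greedyNorm ω q)) ∧
    (B.IsSchauder → B.PropertyI → B.PropertyWStar →
      (∃ q : ℝ≥0∞, 0 < q ∧
        GreedyApprox.ContEmbeds (B.partiallyGreedyNorm ω q) (B.greedyNorm ω q)) →
      B.IsPartiallyGreedy) :=
  have h := theorem1p5_general ω B
  ⟨h.1, h.2 hω hi hB⟩
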